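/- Let $\Bbbk$ be a field of characteristic zero, $r\ge 1$, $\mathfrak g=\mathfrak{sl}_{r+1}(\Bbbk)$ with the Borel subalgebra $\mathfrak b$ of upper triangular matrices, the Cartan subalgebra $\mathfrak t$ of diagonal matrices, the simple roots $\Pi=\{\alpha_1,\dots,\alpha_r\}$, root vectors $e_\alpha$ and the highest root $\lambda$. Let $\widehat{\mathfrak g}=\mathfrak g[t,t^{-1}]\oplus\Bbbk C\oplus\Bbbk d$ be the affine Kac--Moody algebra, where $C$ is central, $[d,xt^m]=m\,xt^m$ and $[xt^m,yt^n]=[x,y]t^{m+n}+m\,\delta_{m,-n}\operatorname{tr}(xy)\,C$. Put $\widehat\Pi=\Pi\sqcup\{\alpha_0\}$, $\mathfrak h=\mathfrak t\oplus\Bbbk C\oplus\Bbbk d$, $\widehat{\mathfrak b}=(\mathfrak b+\mathfrak h)\oplus t\mathfrak g[t]$ and $e_{-\alpha_0}=e_\lambda t^{-1}$. For $S\subset\widehat\Pi$ let $\mathfrak p(S)\subset\widehat{\mathfrak g}$ be the subalgebra generated by $\widehat{\mathfrak b}$ and $\{e_{-\beta}\mid\beta\in S\}$. Let $\omega$ be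 an involution of $\widehat{\mathfrak g}$ with $\omega|_{\mathfrak h}=-\mathrm{id}$ and $\omega(\mathfrak g t^m)=\mathfrak g t^{-m}$ for all $m\in\mathbb Z$, and for $S,S'\subset\widehat\Pi$ put $\widehat{\mathfrak q}(S,S')=\mathfrak p(S)\cap\omega(\mathfrak p(S'))$. Let $\mathfrak p(S\cap\Pi)\subset\mathfrak g$ be the subalgebra generated by $\mathfrak b$ and $\{e_{-\beta}\mid\beta\in S\cap\Pi\}$, let $\mathfrak n(S\cap\Pi)$ be its nilradical, and let $\mathfrak z$ be the centre of $\mathfrak n(S\cap\Pi)$. Let $\mathfrak r^-\subset\mathfrak g$ be the subalgebra generated by $\omega(\mathfrak b)$ and $\{e_\beta\mid\beta\in S'\cap\Pi\}$, and put $\mathfrak q=\mathfrak p(S\cap\Pi)\cap\mathfrak r^-$. Suppose that $S'\subset\Pi$ and that $\widehat{\mathfrak q}=\widehat{\mathfrak q}(S,S')$ is finite-dimensional. Then $\mathfrak q$ is a seaweed in $\mathfrak g$, that is, the intersection of two parabolic subalgebras of $\mathfrak g$ whose sum is $\mathfrak g$. Moreover: (i) if $\alpha_0\notin S$, then $\widehat{\mathfrak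 q}$ is isomorphic to $\mathfrak q\oplus\Bbbk d\oplus\Bbbk C$ as a Lie algebra; (ii) if $\alpha_0\in S$, then $\widehat{\mathfrak q}$ is isomorphic to the semi-direct product $(\mathfrak q\oplus\Bbbk d\oplus\Bbbk C)\ltimes\mathfrak z t^{-1}$, where $\mathfrak z t^{-1}$ is an Abelian ideal on which $a\in\mathfrak q$ acts by $wt^{-1}\mapsto[a,w]t^{-1}$, $d$ acts as $-\mathrm{id}$ and $C$ acts as $0$. In both cases the isomorphism can be taken to be the natural one, which sends $a\in\mathfrak q$, $d$, $C$ and, in case (ii), $wt^{-1}\in\mathfrak z t^{-1}$ to the elements of $\widehat{\mathfrak g}$ of the same name. -/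

import Mathlib

open scoped TensorProduct

attribute [local instance 100] LieRing.ofAssociativeRing

noncomputable section

namespace AffineSeaweed

section FiniteDimensional

variable (k : Type*) [Field k] (r : ℕ)

/-- The Lie algebra `𝔤 = sl_{r+1}(k)`. -/
abbrev SL : Type _ := LieAlgebra.SpecialLinear.sl (Fin (r + 1)) k

/-- The form `(x | y) = tr (x y)` on `𝔤`; it is the normalised invariant form. -/
def form : LinearMap.BilinForm k (SL k r) :=
  LinearMap.mk₂ k (fun x y => Matrix.trace (x.1 * y.1))
    (by intros; simp [add_mul]) (by intros; simp)
    (by intros; simp [mul_add]) (by intros; simp)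

theorem form_apply (x y : SL k r) : form k r x y = Matrix.trace (x.1 * y.1) := rfl

theorem form_symm (x y : SL k r) : form k r x y = form k r y x := by
  simp only [form_apply]; exact Matrix.trace_mul_comm _ _

theorem form_lie (x y z : SL k r) : form k r ⁅x, y⁆ z = form k r x ⁅y, z⁆ := by
  simp only [form_apply, LieAlgebra.SpecialLinear.sl_bracket, sub_mul, mul_sub, Matrix.trace_sub,
    Matrix.mul_assoc]
  rw [← Matrix.mul_assoc x.1 z.1 y.1, Matrix.trace_mul_comm (x.1 * z.1) y.1]

end FiniteDimensional

section Affine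

variable (k : Type*) [Field k] (r : ℕ)

/-- The loop algebra `𝔤[t, t⁻¹] = k[t, t⁻¹] ⊗ 𝔤`. -/
def Loop : Type _ := LieAlgebra.loopAlgebra k ℤ (SL k r)

instance : LieRing (Loop k r) := inferInstanceAs (LieRing (LieAlgebra.loopAlgebra k ℤ (SL k r)))

instance : LieAlgebra k (Loop k r) :=
  inferInstanceAs (LieAlgebra k (LieAlgebra.loopAlgebra k ℤ (SL k r)))

/-- An element of the loop algebra as a finite family of coefficients, `∑ xₘ tᵐ ↦ (xₘ)ₘ`. -/
def Loop.coeffs : Loop k r ≃ₗ[k] (ℤ →₀ SL k r) := LieAlgebra.LoopAlgebra.toFinsupp k ℤ (SL k r)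

/-- The element `x tᵐ` of the loop algebra. -/
def Loop.mono (m : ℤ) : SL k r →ₗ[k] Loop k r :=
  TensorProduct.mk k (AddMonoidAlgebra k ℤ) (SL k r) (AddMonoidAlgebra.single m 1)

theorem Loop.coeffs_mono (m : ℤ) (x : SL k r) :
    Loop.coeffs k r (Loop.mono k r m x) = Finsupp.single m x :=
  LieAlgebra.LoopAlgebra.toFinsupp_single_tmul k ℤ (SL k r) m x

theorem Loop.coeffs_symm_single (m : ℤ) (x : SL k r) :
    (Loop.coeffs k r).symm (Finsupp.single m x) = Loop.mono k r m x :=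
  LieAlgebra.LoopAlgebra.toFinsupp_symm_single k ℤ (SL k r) m x

theorem Loop.lie_mono (m n : ℤ) (x y : SL k r) :
    ⁅Loop.mono k r m x, Loop.mono k r n y⁆ = Loop.mono k r (m + n) ⁅x, y⁆ := by
  refine (LieAlgebra.ExtendScalars.bracket_tmul k (AddMonoidAlgebra k ℤ) (SL k r) (SL k r)
    (AddMonoidAlgebra.single m 1) (AddMonoidAlgebra.single n 1) x y).trans ?_
  rw [AddMonoidAlgebra.single_mul_single, one_mul]
  rfl

/-- The operator `t d/dt` on the loop algebra: `x tᵐ ↦ m x tᵐ`. -/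
def Loop.D : Loop k r →ₗ[k] Loop k r :=
  (Loop.coeffs k r).symm.toLinearMap ∘ₗ
    (Finsupp.lsum k fun m : ℤ => (m : k) • Finsupp.lsingle m) ∘ₗ (Loop.coeffs k r).toLinearMap

theorem Loop.D_mono (m : ℤ) (x : SL k r) :
    Loop.D k r (Loop.mono k r m x) = (m : k) • Loop.mono k r m x := by
  simp only [Loop.D, LinearMap.comp_apply, LinearEquiv.coe_coe, Loop.coeffs_mono,
    Finsupp.lsum_single, LinearMap.smul_apply, Finsupp.lsingle_apply, map_smul,
    Loop.coeffs_symm_single]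

/-- The two-cocycle of the loop algebra, `(x tᵐ, y tⁿ) ↦ m δ_{m,-n} (x | y)`. -/
def Loop.cocycle : Loop k r →ₗ[k] Loop k r →ₗ[k] k :=
  (LieAlgebra.LoopAlgebra.residuePairing k ℤ (SL k r) (form k r)).flip

theorem Loop.cocycle_apply (a b : Loop k r) : Loop.cocycle k r a b =
    (Loop.coeffs k r a).sum fun m x => m • form k r (Loop.coeffs k r b (-m)) x :=
  rfl

theorem Loop.cocycle_mono (m n : ℤ) (x y : SL k r) :
    Loop.cocycle k r (Loop.mono k r m x) (Loop.mono k r n y) =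
      if m + n = 0 then (m : k) * form k r x y else 0 := by
  rw [Loop.cocycle_apply, Loop.coeffs_mono, Loop.coeffs_mono, Finsupp.sum_single_index (by simp)]
  by_cases h : m + n = 0
  · obtain rfl : n = -m := by omega
    simp [form_symm k r y x]
  · rw [if_neg h, Finsupp.single_eq_of_ne (by omega)]
    simp

theorem Loop.induction {p : Loop k r → Prop} (h0 : p 0)
    (hadd : ∀ a b, p a → p b → p (a + b)) (hm : ∀ m x, p (Loop.mono k r m x)) (a : Loop k r) :
    p a := by
  obtain ⟨f, rfl⟩ := (Loop.coeffs k r).symm.surjective a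
  induction f using Finsupp.induction_linear with
  | zero => simpa using h0
  | add f g hf hg => simpa using hadd _ _ hf hg
  | single m x => simpa only [Loop.coeffs_symm_single] using hm m x

theorem Loop.D_lie (a b : Loop k r) :
    Loop.D k r ⁅a, b⁆ = ⁅Loop.D k r a, b⁆ + ⁅a, Loop.D k r b⁆ := by
  induction a using Loop.induction with
  | h0 => simp
  | hadd a a' ha ha' => simp only [add_lie, map_add, ha, ha']; abel
  | hm m x =>
    induction b using Loop.induction with
    | h0 => simp
    | hadd a a' ha ha' => simp only [lie_add, map_add, ha, ha']; abel
    | hm n y =>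
      simp only [Loop.lie_mono, Loop.D_mono, smul_lie, lie_smul, ← add_smul]
      push_cast
      rfl

theorem Loop.cocycle_self (a : Loop k r) : Loop.cocycle k r a a = 0 := by
  have skew : ∀ a b : Loop k r, Loop.cocycle k r a b = - Loop.cocycle k r b a := by
    intro a b
    induction a using Loop.induction with
    | h0 => simp
    | hadd a a' ha ha' => simp only [map_add, LinearMap.add_apply, ha, ha']; abel
    | hm m x =>
      induction b using Loop.induction with
      | h0 => simp
      | hadd a a' ha ha' => simp only [map_add, LinearMap.add_apply, ha, ha']; abel
      | hm n y =>
        rw [Loop.cocycle_mono, Loop.cocycle_mono, add_comm n m]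
        split_ifs with h
        · have : m = -n := by omega
          subst this
          rw [form_symm k r x y]; push_cast; ring
        · simp
  induction a using Loop.induction with
  | h0 => simp
  | hadd a b ha hb =>
    simp only [map_add, LinearMap.add_apply, ha, hb]
    rw [skew a b]; simp
  | hm m x =>
    rw [Loop.cocycle_mono]
    split_ifs with h
    · have : m = 0 := by omega
      simp [this]
    · rfl

theorem Loop.cocycle_skew (a b : Loop k r) : Loop.cocycle k r a b = - Loop.cocycle k r b a := by
  have h := Loop.cocycle_self k r (a + b)
  simp only [map_add, LinearMap.add_apply, Loop.cocycle_self, zero_add, add_zero] at h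
  linear_combination h

theorem Loop.cocycle_lie (a b c : Loop k r) :
    Loop.cocycle k r a ⁅b, c⁆ = Loop.cocycle k r ⁅a, b⁆ c + Loop.cocycle k r b ⁅a, c⁆ := by
  induction a using Loop.induction with
  | h0 => simp
  | hadd a a' ha ha' => simp only [add_lie, map_add, LinearMap.add_apply, ha, ha']; abel
  | hm m x =>
  induction b using Loop.induction with
  | h0 => simp
  | hadd a a' ha ha' => simp only [add_lie, lie_add, map_add, LinearMap.add_apply, ha, ha']; abel
  | hm n y =>
  induction c using Loop.induction with
  | h0 => simp
  | hadd a a' ha ha' => simp only [lie_add, map_add, ha, ha']; abel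
  | hm l z =>
    simp only [Loop.lie_mono, Loop.cocycle_mono]
    by_cases h : m + n + l = 0
    · rw [if_pos (by omega), if_pos h, if_pos (by omega), form_lie,
        form_symm k r y, form_lie, ← lie_skew y z, map_neg]
      push_cast; ring
    · rw [if_neg (by omega), if_neg h, if_neg (by omega), add_zero]

theorem Loop.cocycle_D (a b : Loop k r) :
    Loop.cocycle k r (Loop.D k r a) b + Loop.cocycle k r a (Loop.D k r b) = 0 := by
  induction a using Loop.induction with
  | h0 => simp
  | hadd a a' ha ha' =>
    simp only [map_add, LinearMap.add_apply]; linear_combination ha + ha'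
  | hm m x =>
    induction b using Loop.induction with
    | h0 => simp
    | hadd a a' ha ha' => simp only [map_add] at *; linear_combination ha + ha'
    | hm n y =>
      simp only [Loop.D_mono, map_smul, LinearMap.smul_apply, Loop.cocycle_mono, smul_eq_mul]
      split_ifs with h
      · have : m = -n := by omega
        subst this
        push_cast; ring
      · simp

/-- The affine Kac--Moody algebra `𝔤[t, t⁻¹] ⊕ k C ⊕ k d` of type `A_r⁽¹⁾`: the element
`⟨a, c, δ⟩` is `a + c C + δ d`. -/
@[ext] structure Aff where
  /-- the component in the loop algebra -/
  loop : Loop k r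
  /-- the coefficient of the central element `C` -/
  cen : k
  /-- the coefficient of the derivation `d` -/
  der : k

namespace Aff

/-- The underlying product. -/
def toProd : Aff k r ≃ Loop k r × k × k where
  toFun x := (x.loop, x.cen, x.der)
  invFun x := ⟨x.1, x.2.1, x.2.2⟩
  left_inv _ := rfl
  right_inv _ := rfl

instance : AddCommGroup (Aff k r) := (toProd k r).addCommGroup

instance : Module k (Aff k r) := (toProd k r).module k

variable {k r}

@[simp] theorem zero_loop : (0 : Aff k r).loop = 0 := rfl
@[simp] theorem zero_cen : (0 : Aff k r).cen = 0 := rfl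
@[simp] theorem zero_der : (0 : Aff k r).der = 0 := rfl
@[simp] theorem add_loop (x y : Aff k r) : (x + y).loop = x.loop + y.loop := rfl
@[simp] theorem add_cen (x y : Aff k r) : (x + y).cen = x.cen + y.cen := rfl
@[simp] theorem add_der (x y : Aff k r) : (x + y).der = x.der + y.der := rfl
@[simp] theorem smul_loop (c : k) (x : Aff k r) : (c • x).loop = c • x.loop := rfl
@[simp] theorem smul_cen (c : k) (x : Aff k r) : (c • x).cen = c * x.cen := rfl
@[simp] theorem smul_der (c : k) (x : Aff k r) : (c • x).der = c * x.der := rfl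
@[simp] theorem neg_loop (x : Aff k r) : (-x).loop = -x.loop := rfl
@[simp] theorem neg_cen (x : Aff k r) : (-x).cen = -x.cen := rfl
@[simp] theorem neg_der (x : Aff k r) : (-x).der = -x.der := rfl

/-- `[x tᵐ + c C + δ d, y tⁿ + c' C + δ' d]
  = [x, y] tᵐ⁺ⁿ + δ n y tⁿ - δ' m x tᵐ + m δ_{m,-n} (x | y) C`. -/
instance : Bracket (Aff k r) (Aff k r) where
  bracket x y :=
    ⟨⁅x.loop, y.loop⁆ + x.der • Loop.D k r y.loop - y.der • Loop.D k r x.loop,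
      Loop.cocycle k r x.loop y.loop, 0⟩

@[simp] theorem lie_loop (x y : Aff k r) :
    ⁅x, y⁆.loop = ⁅x.loop, y.loop⁆ + x.der • Loop.D k r y.loop - y.der • Loop.D k r x.loop := rfl
@[simp] theorem lie_cen (x y : Aff k r) : ⁅x, y⁆.cen = Loop.cocycle k r x.loop y.loop := rfl
@[simp] theorem lie_der (x y : Aff k r) : ⁅x, y⁆.der = 0 := rfl

instance : LieRing (Aff k r) where
  add_lie x y z := by
    ext1 <;> simp [add_smul]
    abel
  lie_add x y z := by
    ext1 <;> simp [add_smul]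
    abel
  lie_self x := by
    ext1 <;> simp [Loop.cocycle_self]
  leibniz_lie x y z := by
    ext1
    · simp only [lie_loop, lie_der, add_loop, zero_smul, sub_zero, add_zero, lie_add,
        lie_sub, add_lie, sub_lie, lie_smul, smul_lie, map_add, map_sub, map_smul, Loop.D_lie,
        smul_add, smul_sub, leibniz_lie x.loop y.loop z.loop]
      rw [smul_comm z.der x.der, smul_comm z.der y.der, smul_comm y.der x.der,
        ← lie_skew (Loop.D k r x.loop) y.loop]
      simp only [smul_neg]
      abel
    · simp only [lie_loop, lie_cen, add_cen, map_add, map_sub, map_smul, LinearMap.add_apply,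
        LinearMap.sub_apply, LinearMap.smul_apply, smul_eq_mul]
      linear_combination Loop.cocycle_lie k r x.loop y.loop z.loop
        - x.der * Loop.cocycle_D k r y.loop z.loop
        + y.der * Loop.cocycle_D k r x.loop z.loop - z.der * Loop.cocycle_D k r x.loop y.loop
        + z.der * Loop.cocycle_skew k r (Loop.D k r x.loop) y.loop
    · simp

instance : LieAlgebra k (Aff k r) where
  lie_smul c x y := by
    ext1
    · simp [smul_add, smul_sub, smul_smul, mul_comm]
    · simp
    · simp

variable (k r)

/-- The linear map `x ↦ x tᵐ` from `𝔤` to the affine Kac--Moody algebra. -/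
def t (m : ℤ) : SL k r →ₗ[k] Aff k r where
  toFun x := ⟨Loop.mono k r m x, 0, 0⟩
  map_add' x y := by ext1 <;> simp
  map_smul' c x := by ext1 <;> simp

/-- The central element `C`. -/
def C : Aff k r := ⟨0, 1, 0⟩

/-- The derivation `d`. -/
def d : Aff k r := ⟨0, 0, 1⟩

end Aff
end Affine

section Parabolic

variable (k : Type*) [Field k] (r : ℕ)

/-- The Cartan subalgebra `𝔱` of `𝔤`: the diagonal matrices of trace zero. -/
def cartan : Submodule k (SL k r) where
  carrier := {x | x.1.IsDiag}
  add_mem' hx hy := Matrix.IsDiag.add hx hy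
  zero_mem' := Matrix.isDiag_zero
  smul_mem' c _ hx := Matrix.IsDiag.smul c hx

/-- The Borel subalgebra `𝔟` of `𝔤`: the upper triangular matrices of trace zero. -/
def borel : LieSubalgebra k (SL k r) where
  carrier := {x | x.1.IsUpperTriangular}
  add_mem' hx hy := Matrix.BlockTriangular.add hx hy
  zero_mem' := Matrix.blockTriangular_zero
  smul_mem' c x hx i j hij := by
    show c * x.1 i j = 0
    rw [hx hij, mul_zero]
  lie_mem' hx hy :=
    Matrix.BlockTriangular.sub (Matrix.BlockTriangular.mul hx hy) (Matrix.BlockTriangular.mul hy hx)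

/-- The matrix unit `E i j`, a root vector for the root `ε i - ε j` (and `0` if `i = j`). -/
def rootVec (i j : Fin (r + 1)) : SL k r :=
  if h : i ≠ j then LieAlgebra.SpecialLinear.single i j h 1 else 0

/-- Root vector for the simple root `ε i - ε (i + 1)` of `𝔤`. -/
def ePos (i : Fin r) : SL k r := rootVec k r i.castSucc i.succ

/-- Root vector for the negative of the simple root `ε i - ε (i + 1)` of `𝔤`. -/
def eNeg (i : Fin r) : SL k r := rootVec k r i.succ i.castSucc

/-- Root vector for the highest root of `𝔤`. -/
def eHigh : SL k r := rootVec k r 0 (Fin.last r)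

/-- The standard parabolic subalgebra `𝔭(T)` of `𝔤` for a set `T` of simple roots: it is generated
by `𝔟` and the root vectors `e_{-α}`, `α ∈ T`. -/
def parabolic (T : Set (Fin r)) : LieSubalgebra k (SL k r) :=
  LieSubalgebra.lieSpan k (SL k r) ((borel k r : Set (SL k r)) ∪ eNeg k r '' T)

/-- The Cartan subalgebra `𝔥 = 𝔱 ⊕ k C ⊕ k d`. -/
def affCartan : Submodule k (Aff k r) :=
  (cartan k r).map (Aff.t k r 0) ⊔ Submodule.span k {Aff.C k r, Aff.d k r}

/-- `(𝔟 + 𝔥) ⊕ t 𝔤[t]`. -/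
def affBorel : Submodule k (Aff k r) :=
  (borel k r).toSubmodule.map (Aff.t k r 0) ⊔ affCartan k r ⊔
    ⨆ m : {m : ℤ // 1 ≤ m}, LinearMap.range (Aff.t k r m)

/-- The root vectors `e_{-α₀} = e_λ t⁻¹, e_{-α₁}, …, e_{-α_r}` for the negatives of the simple roots
of the affine Kac--Moody algebra. The index `0` stands for `α₀`, and `i.succ` for the simple root
of `𝔤` with index `i : Fin r`. -/
def affNeg : Fin (r + 1) → Aff k r :=
  Fin.cases (Aff.t k r (-1) (eHigh k r)) fun i => Aff.t k r 0 (eNeg k r i)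

/-- The standard parabolic subalgebra of the affine Kac--Moody algebra for a set `S` of simple
roots. -/
def affParabolic (S : Set (Fin (r + 1))) : LieSubalgebra k (Aff k r) :=
  LieSubalgebra.lieSpan k (Aff k r) ((affBorel k r : Set (Aff k r)) ∪ affNeg k r '' S)

variable {k r}

/-- `ω` is an involution of the affine Kac--Moody algebra that is `-id` on `𝔥` and maps `𝔤 tᵐ` to
`𝔤 t⁻ᵐ` for all `m`. -/
structure IsOpposition (ω : Aff k r ≃ₗ⁅k⁆ Aff k r) : Prop where
  involutive : Function.Involutive ω
  cartan : ∀ x ∈ affCartan k r, ω x = -x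
  degree : ∀ m : ℤ, (LinearMap.range (Aff.t k r m)).map (ω : Aff k r →ₗ[k] Aff k r) =
    LinearMap.range (Aff.t k r (-m))

/-- The standard affine seaweed `𝔭(S) ∩ 𝔭(S')⁻`, where `𝔭(S')⁻ = ω(𝔭(S'))`. -/
def affSeaweed (ω : Aff k r ≃ₗ⁅k⁆ Aff k r) (S S' : Set (Fin (r + 1))) :
    LieSubalgebra k (Aff k r) :=
  affParabolic k r S ⊓ (affParabolic k r S').map ω.toLieHom

/-- The subalgebra of `𝔤` generated by `𝔟⁻ = ω(𝔟)` and the root vectors `e_α`, `α ∈ T`. -/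
def parabolicOpp (ω : Aff k r ≃ₗ⁅k⁆ Aff k r) (T : Set (Fin r)) : LieSubalgebra k (SL k r) :=
  LieSubalgebra.lieSpan k (SL k r)
    ({x | ∃ y ∈ borel k r, ω (Aff.t k r 0 y) = Aff.t k r 0 x} ∪ ePos k r '' T)

/-- The simple roots of `𝔤` in a set `S` of simple roots of the affine algebra. -/
def finitePart (S : Set (Fin (r + 1))) : Set (Fin r) := Fin.succ ⁻¹' S

/-- A Borel subalgebra of `𝔤` is the image of the standard one under an automorphism. -/
def IsBorel (b : LieSubalgebra k (SL k r)) : Prop :=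
  ∃ g : SL k r ≃ₗ⁅k⁆ SL k r, b = (borel k r).map g.toLieHom

/-- A parabolic subalgebra of `𝔤` is one that contains a Borel subalgebra. -/
def IsParabolic (p : LieSubalgebra k (SL k r)) : Prop := ∃ b, IsBorel b ∧ b ≤ p

/-- A seaweed in `𝔤` is the intersection of two parabolic subalgebras whose sum is `𝔤`. -/
def IsSeaweed (q : LieSubalgebra k (SL k r)) : Prop :=
  ∃ p₁ p₂ : LieSubalgebra k (SL k r), IsParabolic p₁ ∧ IsParabolic p₂ ∧
    p₁.toSubmodule ⊔ p₂.toSubmodule = ⊤ ∧ q = p₁ ⊓ p₂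

end Parabolic

section Nilradical

variable (k : Type*) [Field k] (L : Type*) [LieRing L] [LieAlgebra k L]

/-- The nilradical: the sum of all ideals that are nilpotent as Lie algebras. (This differs from
`LieAlgebra.maxNilpotentIdeal`, which uses ideals that are nilpotent as modules over `L`.) -/
def nilradical : LieIdeal k L := sSup {I : LieIdeal k L | LieRing.IsNilpotent I}

/-- The centre of the nilradical, as an ideal of `L`. -/
def nilCentre : LieIdeal k L where
  carrier := {x | x ∈ nilradical k L ∧ ∀ y ∈ nilradical k L, ⁅x, y⁆ = 0}
  add_mem' hx hy := ⟨add_mem hx.1 hy.1, fun z hz => by rw [add_lie, hx.2 z hz, hy.2 z hz, add_zero]⟩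
  zero_mem' := ⟨zero_mem _, fun z _ => zero_lie z⟩
  smul_mem' c x hx := ⟨(nilradical k L).smul_mem c hx.1, fun z hz => by
    rw [smul_lie, hx.2 z hz, smul_zero]⟩
  lie_mem {a x} hx := ⟨(nilradical k L).lie_mem hx.1, fun z hz => by
    rw [lie_lie, hx.2 z hz, lie_zero, hx.2 _ ((nilradical k L).lie_mem hz), sub_zero]⟩

variable {k L}

theorem nilCentre_lie (x y : nilCentre k L) : ⁅x, y⁆ = 0 :=
  Subtype.ext (x.2.2 y.1 y.2.1)

/-- Let `f : Q → L` be a homomorphism and `𝔷` the centre of the nilradical of `L`. The element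
`a + δ d + c C` of `Q ⊕ k d ⊕ k C` acts on the abelian Lie algebra `𝔷 t⁻¹` (identified with `𝔷`) by
`w ↦ [f a, w] - δ w`. -/
def semidirectAction {Q : Type*} [LieRing Q] [LieAlgebra k Q] (f : Q →ₗ⁅k⁆ L) :
    (Q × k × k) →ₗ⁅k⁆ LieDerivation k (nilCentre k L) (nilCentre k L) where
  toFun x :=
    { toFun w := ⁅f x.1, w⁆ - x.2.1 • w
      map_add' v w := by rw [lie_add, smul_add]; abel
      map_smul' c w := by rw [lie_smul, smul_comm, smul_sub]; rfl
      leibniz' v w := by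
        show ⁅f x.1, ⁅v, w⁆⁆ - x.2.1 • ⁅v, w⁆ =
          ⁅v, ⁅f x.1, w⁆ - x.2.1 • w⁆ - ⁅w, ⁅f x.1, v⁆ - x.2.1 • v⁆
        simp only [nilCentre_lie, lie_zero, smul_zero, sub_zero] }
  map_add' x y := by
    ext w : 1
    show ⁅f (x.1 + y.1), w⁆ - (x.2.1 + y.2.1) • w =
      (⁅f x.1, w⁆ - x.2.1 • w) + (⁅f y.1, w⁆ - y.2.1 • w)
    rw [map_add, add_lie, add_smul]; abel
  map_smul' c x := by
    ext w : 1
    show ⁅f (c • x.1), w⁆ - (c * x.2.1) • w = c • (⁅f x.1, w⁆ - x.2.1 • w)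
    rw [map_smul, smul_lie, smul_sub, smul_smul]
  map_lie' {x y} := by
    ext w : 1
    rw [LieDerivation.lie_apply]
    show ⁅f ⁅x.1, y.1⁆, w⁆ - (⁅x, y⁆.2.1) • w =
      (⁅f x.1, ⁅f y.1, w⁆ - y.2.1 • w⁆ - x.2.1 • (⁅f y.1, w⁆ - y.2.1 • w)) -
      (⁅f y.1, ⁅f x.1, w⁆ - x.2.1 • w⁆ - y.2.1 • (⁅f x.1, w⁆ - x.2.1 • w))
    have h : ⁅x, y⁆.2.1 = 0 := by
      show x.2.1 * y.2.1 - y.2.1 * x.2.1 = 0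
      ring
    rw [h, zero_smul, LieHom.map_lie, lie_lie]
    simp only [lie_sub, lie_smul, smul_sub]
    rw [smul_comm x.2.1 y.2.1]
    abel

end Nilradical

section Existence

variable (k : Type*) [Field k] (r : ℕ)

/-- The Chevalley involution `x ↦ -xᵀ` of `𝔤`. -/
def negTranspose : SL k r →ₗ[k] SL k r where
  toFun x := ⟨-x.1.transpose, by
    have h : Matrix.trace x.1 = 0 := x.2
    show Matrix.trace (-x.1.transpose) = 0
    rw [Matrix.trace_neg, Matrix.trace_transpose, h, neg_zero]⟩
  map_add' x y := by
    ext i j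
    show -(x.1 j i + y.1 j i) = -x.1 j i + -y.1 j i
    ring
  map_smul' c x := by
    ext i j
    show -(c * x.1 j i) = c * -x.1 j i
    ring

theorem negTranspose_val (x : SL k r) : (negTranspose k r x).1 = -x.1.transpose := rfl

theorem negTranspose_negTranspose (x : SL k r) : negTranspose k r (negTranspose k r x) = x := by
  ext i j
  exact neg_neg _

theorem negTranspose_lie (x y : SL k r) :
    negTranspose k r ⁅x, y⁆ = ⁅negTranspose k r x, negTranspose k r y⁆ := by
  apply Subtype.ext
  rw [LieAlgebra.SpecialLinear.sl_bracket, negTranspose_val, negTranspose_val, negTranspose_val,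
    LieAlgebra.SpecialLinear.sl_bracket, neg_mul_neg, neg_mul_neg, Matrix.transpose_sub,
    Matrix.transpose_mul, Matrix.transpose_mul, neg_sub]

theorem form_negTranspose (x y : SL k r) :
    form k r (negTranspose k r x) (negTranspose k r y) = form k r x y := by
  rw [form_symm]
  rw [form_apply, form_apply, negTranspose_val, negTranspose_val, neg_mul_neg,
    ← Matrix.transpose_mul, Matrix.trace_transpose]

/-- `x tᵐ ↦ -xᵀ t⁻ᵐ`. -/
def Loop.opp : Loop k r →ₗ[k] Loop k r :=
  (Finsupp.lsum k fun m : ℤ => Loop.mono k r (-m) ∘ₗ negTranspose k r) ∘ₗ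
    (Loop.coeffs k r).toLinearMap

theorem Loop.opp_mono (m : ℤ) (x : SL k r) :
    Loop.opp k r (Loop.mono k r m x) = Loop.mono k r (-m) (negTranspose k r x) := by
  simp only [Loop.opp, LinearMap.comp_apply, LinearEquiv.coe_coe, Loop.coeffs_mono,
    Finsupp.lsum_single]

theorem Loop.opp_opp (a : Loop k r) : Loop.opp k r (Loop.opp k r a) = a := by
  induction a using Loop.induction with
  | h0 => simp
  | hadd a b ha hb => simp only [map_add, ha, hb]
  | hm m x =>
    rw [Loop.opp_mono, Loop.opp_mono, neg_neg, negTranspose_negTranspose]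

theorem Loop.opp_lie (a b : Loop k r) :
    Loop.opp k r ⁅a, b⁆ = ⁅Loop.opp k r a, Loop.opp k r b⁆ := by
  induction a using Loop.induction with
  | h0 => simp
  | hadd a a' ha ha' => simp only [add_lie, map_add, ha, ha']
  | hm m x =>
    induction b using Loop.induction with
    | h0 => simp
    | hadd a a' ha ha' => simp only [lie_add, map_add, ha, ha']
    | hm n y => rw [Loop.lie_mono, Loop.opp_mono, Loop.opp_mono, Loop.opp_mono, Loop.lie_mono,
        negTranspose_lie, neg_add]

theorem Loop.opp_D (a : Loop k r) : Loop.opp k r (Loop.D k r a) = -Loop.D k r (Loop.opp k r a) := by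
  induction a using Loop.induction with
  | h0 => simp
  | hadd a b ha hb => simp only [map_add, ha, hb]; abel
  | hm m x => simp [Loop.opp_mono, Loop.D_mono]

theorem Loop.opp_cocycle (a b : Loop k r) :
    Loop.cocycle k r (Loop.opp k r a) (Loop.opp k r b) = -Loop.cocycle k r a b := by
  induction a using Loop.induction with
  | h0 => simp
  | hadd a a' ha ha' => simp only [map_add, LinearMap.add_apply, ha, ha']; abel
  | hm m x =>
    induction b using Loop.induction with
    | h0 => simp
    | hadd a a' ha ha' => simp only [map_add, ha, ha']; abel
    | hm n y =>
      simp only [Loop.opp_mono, Loop.cocycle_mono, form_negTranspose]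
      by_cases h : m + n = 0
      · rw [if_pos (by omega), if_pos h]; push_cast; ring
      · rw [if_neg (by omega), if_neg h, neg_zero]

/-- The Chevalley involution of the affine Kac--Moody algebra:
`x tᵐ + c C + δ d ↦ -xᵀ t⁻ᵐ - c C - δ d`. -/
def chevalley : Aff k r ≃ₗ⁅k⁆ Aff k r where
  toFun x := ⟨Loop.opp k r x.loop, -x.cen, -x.der⟩
  invFun x := ⟨Loop.opp k r x.loop, -x.cen, -x.der⟩
  map_add' x y := by ext1 <;> simp [add_comm]
  map_smul' c x := by ext1 <;> simp
  map_lie' {x y} := by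
    ext1
    · simp [Loop.opp_lie, Loop.opp_D]
    · simp [Loop.opp_cocycle]
    · simp
  left_inv x := by ext1 <;> simp [Loop.opp_opp]
  right_inv x := by ext1 <;> simp [Loop.opp_opp]

theorem chevalley_t (m : ℤ) (x : SL k r) :
    chevalley k r (Aff.t k r m x) = Aff.t k r (-m) (negTranspose k r x) := by
  show (⟨Loop.opp k r (Loop.mono k r m x), -0, -0⟩ : Aff k r) = _
  rw [Loop.opp_mono, neg_zero]
  rfl

theorem isOpposition_chevalley : IsOpposition (chevalley k r) where
  involutive x := (chevalley k r).left_inv x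
  cartan x hx := by
    have h1 : ∀ y ∈ (cartan k r).map (Aff.t k r 0), chevalley k r y = -y := by
      rintro _ ⟨x, hx, rfl⟩
      rw [chevalley_t, neg_zero, ← map_neg]
      congr 1
      ext i j
      show -x.1 j i = -x.1 i j
      by_cases h : i = j
      · rw [h]
      · rw [hx h, hx (Ne.symm h)]
    have h2 : ∀ y ∈ Submodule.span k {Aff.C k r, Aff.d k r}, chevalley k r y = -y := by
      intro y hy
      obtain ⟨a, b, rfl⟩ := Submodule.mem_span_pair.1 hy
      have hC : chevalley k r (Aff.C k r) = -Aff.C k r := by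
        ext1
        · exact (map_zero (Loop.opp k r)).trans neg_zero.symm
        · rfl
        · rfl
      have hd : chevalley k r (Aff.d k r) = -Aff.d k r := by
        ext1
        · exact (map_zero (Loop.opp k r)).trans neg_zero.symm
        · rfl
        · rfl
      rw [map_add, map_smul, map_smul, hC, hd, smul_neg, smul_neg, neg_add]
    obtain ⟨y, hy, z, hz, rfl⟩ := Submodule.mem_sup.1 hx
    rw [map_add, h1 y hy, h2 z hz, neg_add]
  degree m := by
    ext z
    constructor
    · rintro ⟨_, ⟨x, rfl⟩, rfl⟩
      exact ⟨negTranspose k r x, (chevalley_t k r m x).symm⟩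
    · rintro ⟨x, rfl⟩
      refine ⟨_, ⟨negTranspose k r x, rfl⟩, (chevalley_t k r m _).trans ?_⟩
      rw [negTranspose_negTranspose]

end Existence

end AffineSeaweed

end

noncomputable section

namespace AffineSeaweed

/-! ### Root vectors, the staircase filtration of `sl`, and standard parabolics as block matrices.
-/

section Staircase

variable {k : Type*} [Field k] {r : ℕ}

/-! Everything is read off from one filtration. For `g : Fin (r + 1) → ℤ` let `F_c` be `staircase k
g c`; then `[F_c, F_c'] ⊆ F_(c+c')`. Take `g = blockIndex T` for `T = S ∩ Π`, the block number, with
values from `0` to `K = g (Fin.last r)`. The parabolic of `T` is `F_0` (`mem_parabolic_iff`), and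
the centre of its nilradical is the corner block `F_(-K)` as soon as `K ≥ 1`
(`mem_nilCentre_parabolic_iff`).

In the affine algebra, requiring the coefficient of `tᵐ` to lie in `F_(mN)` defines a subalgebra. It
contains `𝔭(S)` for `N = K` always, and also for larger `N` when `α₀ ∉ S`
(`affParabolic_le_affStaircase`). With `N = K + 1` all negative degrees vanish; with `N = K ≥ 1`
only degree `-1` survives among them, with coefficients in `F_(-K)`. Since `α₀ ∉ S'`, the first
bound applied to `𝔭(S')` and transported by `ω` removes all positive degrees from the seaweed. What
is left is `𝔮` in degree `0`, then `C`, `d`, and at most `F_(-K) t⁻¹` (`coeffs_of_mem_affSeaweed`).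
Conversely, if `α₀ ∈ S`, all of `F_(-K) t⁻¹` is obtained from `e_λ t⁻¹` by bracketing with Levi root
vectors (`t_neg_one_mem_affParabolic`).

Finite dimension serves only to exclude `K = 0` when `α₀ ∈ S`: in that case `S` is everything and
`𝔭(S)` contains `e_λ t⁻ᵐ` for all `m ≥ 1` (`one_le_blockIndex_of_finiteDimensional`). -/

theorem lie_val_apply (x y : SL k r) (i j : Fin (r + 1)) :
    (⁅x, y⁆ : SL k r).1 i j = ∑ l, (x.1 i l * y.1 l j - y.1 i l * x.1 l j) := by
  rw [LieAlgebra.SpecialLinear.sl_bracket, Matrix.sub_apply, Matrix.mul_apply, Matrix.mul_apply,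
    Finset.sum_sub_distrib]

theorem rootVec_apply (i j a b : Fin (r + 1)) :
    (rootVec k r i j).1 a b = if i ≠ j ∧ i = a ∧ j = b then 1 else 0 := by
  unfold rootVec
  split_ifs with h h' h'
  · rw [LieAlgebra.SpecialLinear.val_single, Matrix.single_apply, if_pos h'.2]
  · rw [LieAlgebra.SpecialLinear.val_single, Matrix.single_apply, if_neg fun h2 => h' ⟨h, h2⟩]
  · exact absurd h'.1 h
  · rfl

theorem rootVec_ne_zero {i j : Fin (r + 1)} (h : i ≠ j) : rootVec k r i j ≠ 0 := by
  intro h0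
  have := rootVec_apply (k := k) i j i j
  rw [h0, if_pos ⟨h, rfl, rfl⟩] at this
  exact zero_ne_one this

theorem rootVec_val {i j : Fin (r + 1)} (h : i ≠ j) :
    (rootVec k r i j).1 = Matrix.single i j 1 := by
  rw [rootVec, dif_pos h, LieAlgebra.SpecialLinear.val_single]

theorem lie_rootVec_rootVec {i j l : Fin (r + 1)} (hij : i ≠ j) (hjl : j ≠ l) (hil : i ≠ l) :
    ⁅rootVec k r i j, rootVec k r j l⁆ = rootVec k r i l := by
  apply Subtype.ext
  rw [LieAlgebra.SpecialLinear.sl_bracket, rootVec_val hij, rootVec_val hjl, rootVec_val hil,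
    Matrix.single_mul_single_same, Matrix.single_mul_single_of_ne _ _ _ _ hil.symm]
  simp

/-- The coroot `E i i - E j j`. -/
def coroot (k : Type*) [Field k] (r : ℕ) (i j : Fin (r + 1)) : SL k r :=
  LieAlgebra.SpecialLinear.singleSubSingle i j 1

theorem coroot_val (i j : Fin (r + 1)) :
    (coroot k r i j).1 = Matrix.diagonal (Pi.single i 1 - Pi.single j 1) := by
  rw [coroot, LieAlgebra.SpecialLinear.val_singleSubSingle, ← Matrix.diagonal_single,
    ← Matrix.diagonal_single, Matrix.diagonal_sub]
  rfl

theorem coroot_mem_cartan (i j : Fin (r + 1)) : coroot k r i j ∈ cartan k r := by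
  change (coroot k r i j).1.IsDiag
  rw [coroot_val]
  exact Matrix.isDiag_diagonal _

theorem lie_coroot_apply (i j a b : Fin (r + 1)) (x : SL k r) :
    (⁅coroot k r i j, x⁆ : SL k r).1 a b =
      ((Pi.single i 1 - Pi.single j 1 : Fin (r + 1) → k) a -
        (Pi.single i 1 - Pi.single j 1 : Fin (r + 1) → k) b) * x.1 a b := by
  rw [LieAlgebra.SpecialLinear.sl_bracket, coroot_val, Matrix.sub_apply, Matrix.diagonal_mul,
    Matrix.mul_diagonal]
  ring

theorem lie_rootVec_rootVec_self {i j : Fin (r + 1)} (h : i ≠ j) :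
    ⁅rootVec k r i j, rootVec k r j i⁆ = coroot k r i j := by
  apply Subtype.ext
  rw [LieAlgebra.SpecialLinear.sl_bracket, rootVec_val h, rootVec_val h.symm,
    Matrix.single_mul_single_same, Matrix.single_mul_single_same, coroot,
    LieAlgebra.SpecialLinear.val_singleSubSingle]
  simp

theorem lie_coroot_rootVec {i j : Fin (r + 1)} (h : i ≠ j) :
    ⁅coroot k r i j, rootVec k r i j⁆ = (2 : k) • rootVec k r i j := by
  ext a b
  rw [lie_coroot_apply]
  change _ = 2 * (rootVec k r i j).1 a b
  rw [rootVec_apply]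
  split_ifs with h'
  · obtain ⟨-, rfl, rfl⟩ := h'
    simp [h, h.symm]
    norm_num
  · simp

/-- The matrix entry at `(i, j)`. -/
def entry (k : Type*) [Field k] {r : ℕ} (i j : Fin (r + 1)) : SL k r →ₗ[k] k :=
  Matrix.entryLinearMap k k i j ∘ₗ (LieAlgebra.SpecialLinear.sl (Fin (r + 1)) k).toSubmodule.subtype

theorem entry_apply (i j : Fin (r + 1)) (x : SL k r) : entry k i j x = x.1 i j := rfl

theorem sum_smul_rootVec_apply (c : Fin (r + 1) → Fin (r + 1) → k) (a b : Fin (r + 1)) :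
    (∑ i, ∑ j, c i j • rootVec k r i j).1 a b = if a = b then 0 else c a b := by
  rw [← entry_apply]
  simp only [map_sum, map_smul, entry_apply, rootVec_apply]
  rw [Finset.sum_eq_single a, Finset.sum_eq_single b]
  · by_cases h : a = b <;> simp [h]
  · intro j _ hj; simp [hj]
  · simp
  · intro i _ hi; exact Finset.sum_eq_zero fun j _ => by simp [hi]
  · simp

theorem exists_cartan_add_sum_rootVec (x : SL k r) :
    ∃ h ∈ cartan k r, x = h + ∑ i, ∑ j, x.1 i j • rootVec k r i j := by
  refine ⟨x - ∑ i, ∑ j, x.1 i j • rootVec k r i j, ?_, by abel⟩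
  intro a b hab
  exact sub_eq_zero.2 ((sum_smul_rootVec_apply x.1 a b).trans (if_neg hab)).symm

theorem eq_sum_rootVec {x : SL k r} (hx : ∀ i, x.1 i i = 0) :
    x = ∑ i, ∑ j, x.1 i j • rootVec k r i j := by
  ext a b
  refine Eq.trans ?_ (sum_smul_rootVec_apply x.1 a b).symm
  split_ifs with h
  · rw [← h]; exact hx a
  · rfl

/-- The matrices whose entry at `(i, j)` vanishes unless `g i ≤ g j + c`. -/
def staircase (k : Type*) [Field k] (g : Fin (r + 1) → ℤ) (c : ℤ) : Submodule k (SL k r) where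
  carrier := {x | ∀ i j, g j + c < g i → x.1 i j = 0}
  add_mem' {x y} hx hy i j h := by
    change x.1 i j + y.1 i j = 0
    rw [hx i j h, hy i j h, add_zero]
  zero_mem' _ _ _ := rfl
  smul_mem' a x hx i j h := by
    change a * x.1 i j = 0
    rw [hx i j h, mul_zero]

variable {g : Fin (r + 1) → ℤ}

/-- In a nonzero term `x i l * y l j` the inequalities `g i ≤ g l + c` and `g l ≤ g j + c'` add up.
-/
theorem lie_mem_staircase {c c' : ℤ} {x y : SL k r} (hx : x ∈ staircase k g c)
    (hy : y ∈ staircase k g c') : ⁅x, y⁆ ∈ staircase k g (c + c') := by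
  intro i j h
  rw [lie_val_apply]
  refine Finset.sum_eq_zero fun l _ => ?_
  have h1 : x.1 i l * y.1 l j = 0 := by
    by_cases hl : g l + c < g i
    · rw [hx i l hl, zero_mul]
    · rw [hy l j (by omega), mul_zero]
  have h2 : y.1 i l * x.1 l j = 0 := by
    by_cases hl : g l + c' < g i
    · rw [hy i l hl, zero_mul]
    · rw [hx l j (by omega), mul_zero]
  rw [h1, h2, sub_zero]

theorem staircase_mono {c c' : ℤ} (h : c ≤ c') : staircase k g c ≤ staircase k g c' :=
  fun _ hx i j hij => hx i j (by omega)

theorem rootVec_mem_staircase {c : ℤ} {i j : Fin (r + 1)} (h : g i ≤ g j + c) :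
    rootVec k r i j ∈ staircase k g c := by
  intro a b hab
  rw [rootVec_apply, if_neg]
  rintro ⟨-, rfl, rfl⟩
  omega

theorem staircase_eq_bot {c : ℤ} (h : ∀ i j, g j + c < g i) : staircase k g c = ⊥ := by
  rw [eq_bot_iff]
  intro x hx
  rw [Submodule.mem_bot]
  ext i j
  exact hx i j (h i j)

theorem staircase_eq_top {c : ℤ} (h : ∀ i j, g i ≤ g j + c) : staircase k g c = ⊤ := by
  rw [eq_top_iff]
  intro x _ i j hij
  exact absurd hij (not_lt.2 (h i j))

/-- The block upper triangular matrices, the blocks being the fibres of `g`. -/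
def blockSubalgebra (k : Type*) [Field k] (g : Fin (r + 1) → ℤ) : LieSubalgebra k (SL k r) where
  __ := staircase k g 0
  lie_mem' hx hy := by simpa using lie_mem_staircase hx hy

/-- Reduces inclusions of staircases to root vectors; the diagonal part is either absorbed by `V` or
absent. -/
theorem mem_of_rootVec_mem {c : ℤ} {x : SL k r} {V : Submodule k (SL k r)}
    (hx : x ∈ staircase k g c)
    (hV : cartan k r ≤ V ∨ ∀ i, x.1 i i = 0)
    (h : ∀ i j, i ≠ j → g i ≤ g j + c → rootVec k r i j ∈ V) : x ∈ V := by
  have hs : ∑ i, ∑ j, x.1 i j • rootVec k r i j ∈ V := by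
    refine Submodule.sum_mem _ fun i _ => Submodule.sum_mem _ fun j _ => ?_
    by_cases hij : i = j
    · simp [rootVec, hij]
    by_cases hg : g i ≤ g j + c
    · exact V.smul_mem _ (h i j hij hg)
    · rw [hx i j (not_le.1 hg), zero_smul]
      exact V.zero_mem
  rcases hV with hV | hV
  · obtain ⟨y, hy, hxe⟩ := exists_cartan_add_sum_rootVec x
    rw [hxe]
    exact V.add_mem (hV hy) hs
  · rw [eq_sum_rootVec hV]
    exact hs

open Classical in
/-- The number of simple roots outside `T` that precede the index `i`. -/
def blockIndex (T : Set (Fin r)) (i : Fin (r + 1)) : ℤ :=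
  -- The bound `c < r` always holds here because `c < i ≤ r`; the quantifier only provides the proof
  -- needed to form the index.
  ∑ c ∈ Finset.range i, if ∀ h : c < r, ⟨c, h⟩ ∈ T then 0 else 1

theorem blockIndex_zero (T : Set (Fin r)) : blockIndex T 0 = 0 := by simp [blockIndex]

open Classical in
theorem blockIndex_succ (T : Set (Fin r)) (i : Fin r) :
    blockIndex T i.succ = blockIndex T i.castSucc + if i ∈ T then 0 else 1 := by
  simp [blockIndex, Finset.sum_range_succ]

theorem blockIndex_mono (T : Set (Fin r)) : Monotone (blockIndex T) := by
  rw [Fin.monotone_iff_le_succ]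
  intro i
  rw [blockIndex_succ]
  split_ifs <;> omega

theorem blockIndex_nonneg (T : Set (Fin r)) (i : Fin (r + 1)) : 0 ≤ blockIndex T i := by
  rw [← blockIndex_zero T]
  exact blockIndex_mono T (Fin.zero_le i)

theorem blockIndex_le (T : Set (Fin r)) (i : Fin (r + 1)) :
    blockIndex T i ≤ blockIndex T (Fin.last r) :=
  blockIndex_mono T (Fin.le_last i)

theorem cartan_le_borel : cartan k r ≤ (borel k r).toSubmodule :=
  fun _ hx _ _ hij => hx (ne_of_gt hij)

theorem rootVec_mem_borel {i j : Fin (r + 1)} (h : i < j) : rootVec k r i j ∈ borel k r := by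
  intro a b hab
  rw [rootVec_apply, if_neg]
  rintro ⟨-, rfl, rfl⟩
  exact lt_asymm h hab

theorem borel_le_parabolic (T : Set (Fin r)) : borel k r ≤ parabolic k r T :=
  fun _ hx => LieSubalgebra.subset_lieSpan (Or.inl hx)

theorem eNeg_mem_parabolic {T : Set (Fin r)} {i : Fin r} (hi : i ∈ T) :
    eNeg k r i ∈ parabolic k r T :=
  LieSubalgebra.subset_lieSpan (Or.inr ⟨i, hi, rfl⟩)

/-- Below the diagonal, `E (i+1) j = [E (i+1) i, E i j]` peels off one simple root at a time. All of
these roots lie in `T`, since `blockIndex` cannot jump between `j` and `i + 1`. -/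
theorem rootVec_mem_parabolic {T : Set (Fin r)} (i : Fin (r + 1)) :
    ∀ j, i ≠ j → blockIndex T i ≤ blockIndex T j → rootVec k r i j ∈ parabolic k r T := by
  induction i using Fin.induction with
  | zero =>
    intro j hj _
    exact borel_le_parabolic T (rootVec_mem_borel (Fin.pos_of_ne_zero hj.symm))
  | succ i ih =>
    intro j hj h
    rcases lt_or_gt_of_ne hj with hlt | hlt
    · exact borel_le_parabolic T (rootVec_mem_borel hlt)
    have hle : j ≤ i.castSucc := Fin.le_castSucc_iff.2 hlt
    have hm := blockIndex_mono T hle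
    have hs := blockIndex_succ T i
    have hi : i ∈ T := by
      by_contra hi
      rw [if_neg hi] at hs
      omega
    rw [if_pos hi] at hs
    rcases eq_or_ne i.castSucc j with rfl | hne
    · exact eNeg_mem_parabolic hi
    · rw [← lie_rootVec_rootVec (ne_of_gt (Fin.castSucc_lt_succ (i := i))) hne hj]
      exact LieSubalgebra.lie_mem _ (eNeg_mem_parabolic hi) (ih j hne (by omega))

theorem mem_parabolic_iff {T : Set (Fin r)} {x : SL k r} :
    x ∈ parabolic k r T ↔ x ∈ staircase k (blockIndex T) 0 := by
  constructor
  · suffices parabolic k r T ≤ blockSubalgebra k (blockIndex T) from fun hx => this hx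
    rw [parabolic, LieSubalgebra.lieSpan_le]
    rintro y (hy | ⟨i, hi, rfl⟩)
    · intro _ _ hij
      exact hy (by
        by_contra h
        have := blockIndex_mono T (not_lt.1 h)
        simp only [id] at this
        omega)
    · refine rootVec_mem_staircase ?_
      rw [blockIndex_succ, if_pos hi]
  · intro hx
    refine mem_of_rootVec_mem (V := (parabolic k r T).toSubmodule) hx
      (Or.inl (cartan_le_borel.trans (borel_le_parabolic T))) fun i j hij h => ?_
    exact rootVec_mem_parabolic i j hij (by omega)

end Staircase

/-! ### The centre of the nilradical of a standard parabolic. -/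

section ParabolicNilradical

variable {k : Type*} [Field k] {r : ℕ}

theorem lie_rootVec_apply (x : SL k r) {a b : Fin (r + 1)} (hab : a ≠ b) (i j : Fin (r + 1)) :
    (⁅x, rootVec k r a b⁆ : SL k r).1 i j =
      (if b = j then x.1 i a else 0) - (if a = i then x.1 b j else 0) := by
  simp only [lie_val_apply, rootVec_apply, Finset.sum_sub_distrib]
  congr 1
  · rw [Finset.sum_eq_single a]
    · simp [hab]
    · intro l _ hl; simp [hl.symm]
    · simp
  · rw [Finset.sum_eq_single b]
    · simp [hab]
    · intro l _ hl; simp [hl.symm]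
    · simp

theorem coroot_eigenvalue_cases {a b : Fin (r + 1)} (hab : a ≠ b) (i j : Fin (r + 1)) :
    let d := (Pi.single a 1 - Pi.single b 1 : Fin (r + 1) → k) i -
      (Pi.single a 1 - Pi.single b 1 : Fin (r + 1) → k) j
    (i = a ∧ j = b ∧ d = 2) ∨ (i = b ∧ j = a ∧ d = -2) ∨
      (¬ (i = a ∧ j = b) ∧ ¬ (i = b ∧ j = a) ∧ (d = 0 ∨ d = 1 ∨ d = -1)) := by
  intro d
  simp only [d, Pi.sub_apply, Pi.single_apply]
  by_cases h1 : i = a <;> by_cases h2 : i = b <;> by_cases h3 : j = a <;> by_cases h4 : j = b <;>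
    first
      | (exfalso; exact hab (h1.symm.trans h2))
      | (exfalso; exact hab (h3.symm.trans h4))
      | (simp [h1, h2, h3, h4, hab, hab.symm]; try norm_num)

/-- The eigenvalue `2` of the coroot occurs only at the entry `(a, b)`, so a polynomial in its
adjoint action projects `x` onto a multiple of `E a b`. -/
theorem rootVec_mem_of_coroot_stable [CharZero k] {V : Submodule k (SL k r)} {a b : Fin (r + 1)}
    (hab : a ≠ b) (hV : ∀ x ∈ V, ⁅coroot k r a b, x⁆ ∈ V) {x : SL k r} (hx : x ∈ V)
    (hne : x.1 a b ≠ 0) : rootVec k r a b ∈ V := by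
  let step (c : k) (y : SL k r) : SL k r := ⁅coroot k r a b, y⁆ - c • y
  have hstep : ∀ c, ∀ y ∈ V, step c y ∈ V :=
    fun c y hy => V.sub_mem (hV y hy) (V.smul_mem c hy)
  have hstep_apply : ∀ c y i j, (step c y).1 i j =
      ((Pi.single a 1 - Pi.single b 1 : Fin (r + 1) → k) i -
        (Pi.single a 1 - Pi.single b 1 : Fin (r + 1) → k) j - c) * y.1 i j := by
    intro c y i j
    change (⁅coroot k r a b, y⁆ : SL k r).1 i j - c * y.1 i j = _
    rw [lie_coroot_apply]
    ring
  -- The four factors kill the eigenvalues `0, -2, -1, 1`; at the eigenvalue `2` their product is `2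
  -- * 4 * 3 * 1 = 24`.
  have key : step 1 (step (-1) (step (-2) (step 0 x))) = (24 * x.1 a b) • rootVec k r a b := by
    ext i j
    change _ = 24 * x.1 a b * (rootVec k r a b).1 i j
    simp only [hstep_apply]
    rw [rootVec_apply]
    rcases coroot_eigenvalue_cases (k := k) hab i j with ⟨rfl, rfl, hd⟩ | ⟨rfl, rfl, hd⟩ |
      ⟨hn, -, hd⟩
    · rw [hd, if_pos ⟨hab, rfl, rfl⟩]; ring
    · rw [hd, if_neg (fun h => hab h.2.1)]; ring
    · rw [if_neg (fun h => hn ⟨h.2.1.symm, h.2.2.symm⟩)]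
      rcases hd with hd | hd | hd <;> rw [hd] <;> ring
  have hmem := hstep 1 _ (hstep (-1) _ (hstep (-2) _ (hstep 0 _ hx)))
  rw [key] at hmem
  exact (V.smul_mem_iff (mul_ne_zero (by norm_num) hne)).1 hmem

/-- In a nilpotent ideal `ad x` acts nilpotently, hence has no nonzero eigenvalue. This is the only
consequence of nilpotency used below. -/
theorem eq_zero_of_lie_eq_smul {L : Type*} [LieRing L] [LieAlgebra k L] {I : LieIdeal k L}
    (hI : LieRing.IsNilpotent I) {x y : L} (hx : x ∈ I) (hy : y ∈ I) {c : k} (hc : c ≠ 0)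
    (h : ⁅x, y⁆ = c • y) : y = 0 := by
  obtain ⟨m, hm⟩ := LieModule.exists_forall_pow_toEnd_eq_zero k I I
  have hpow : ∀ m : ℕ, ((LieModule.toEnd k I I ⟨x, hx⟩) ^ m) ⟨y, hy⟩ = c ^ m • (⟨y, hy⟩ : I) := by
    intro m
    induction m with
    | zero => simp
    | succ m ih =>
      rw [pow_succ', Module.End.mul_apply, ih, map_smul, pow_succ, mul_smul]
      congr 1
      exact Subtype.ext h
  have h0 := hpow m
  rw [hm] at h0
  have h1 := (smul_eq_zero.1 h0.symm).resolve_left (pow_ne_zero m hc)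
  exact congrArg Subtype.val h1

variable {T : Set (Fin r)}

theorem staircase_le_parabolic {c : ℤ} (hc : c ≤ 0) {x : SL k r}
    (hx : x ∈ staircase k (blockIndex T) c) : x ∈ parabolic k r T :=
  mem_parabolic_iff.2 (staircase_mono hc hx)

theorem coroot_mem_parabolic (a b : Fin (r + 1)) : coroot k r a b ∈ parabolic k r T :=
  borel_le_parabolic T (cartan_le_borel (coroot_mem_cartan a b))

/-- The ideal of the parabolic subalgebra formed by its elements in `staircase k (blockIndex T) c`. -/
def staircaseIdeal (k : Type*) [Field k] (T : Set (Fin r)) (c : ℤ) :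
    LieIdeal k (parabolic k r T) where
  __ := (staircase k (blockIndex T) c).comap (parabolic k r T).toSubmodule.subtype
  lie_mem {a x} hx := by
    have := lie_mem_staircase (mem_parabolic_iff.1 a.2) hx
    rwa [zero_add] at this

theorem mem_staircaseIdeal {c : ℤ} {x : parabolic k r T} :
    x ∈ staircaseIdeal k T c ↔ x.1 ∈ staircase k (blockIndex T) c := Iff.rfl

theorem lowerCentralSeries_staircaseIdeal (m : ℕ) :
    ∀ y ∈ LieModule.lowerCentralSeries k (staircaseIdeal k T (-1)) (staircaseIdeal k T (-1)) m,
      y.1 ∈ staircaseIdeal k T (-(m + 1)) := by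
  induction m with
  | zero => intro y _; exact y.2
  | succ m ih =>
    let F : LieIdeal k (staircaseIdeal k T (-1)) :=
      (staircaseIdeal k T (-((m + 1 : ℕ) + 1))).comap (staircaseIdeal k T (-1)).incl
    suffices LieModule.lowerCentralSeries k (staircaseIdeal k T (-1))
        (staircaseIdeal k T (-1)) (m + 1) ≤ F from fun y hy => LieIdeal.mem_comap.1 (this hy)
    rw [LieModule.lowerCentralSeries_succ, LieSubmodule.lie_le_iff]
    intro x _ y hy
    refine LieIdeal.mem_comap.2 ?_
    have h := lie_mem_staircase (mem_staircaseIdeal.1 x.2) (mem_staircaseIdeal.1 (ih y hy))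
    rw [show (-1 : ℤ) + -(m + 1) = -((m + 1 : ℕ) + 1) by push_cast; ring] at h
    exact h

theorem isNilpotent_staircaseIdeal : LieRing.IsNilpotent (staircaseIdeal k T (-1)) := by
  refine LieModule.IsNilpotent.mk (R := k) (L := staircaseIdeal k T (-1))
    (M := staircaseIdeal k T (-1)) (k := (blockIndex T (Fin.last r)).toNat) ?_
  rw [eq_bot_iff]
  intro y hy
  have h := mem_staircaseIdeal.1 (lowerCentralSeries_staircaseIdeal _ y hy)
  -- The block numbers lie between `0` and `K`, so a shift by `-(K + 1)` leaves no admissible entry.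
  have hbot : staircase k (blockIndex T) (-((blockIndex T (Fin.last r)).toNat + 1)) = ⊥ := by
    refine staircase_eq_bot fun i j => ?_
    have h1 := blockIndex_nonneg T i
    have h2 := blockIndex_le T j
    omega
  rw [hbot, Submodule.mem_bot] at h
  exact (LieSubmodule.mem_bot y).2 (Subtype.ext (Subtype.ext h))

theorem staircaseIdeal_le_nilradical :
    staircaseIdeal k T (-1) ≤ nilradical k (parabolic k r T) :=
  le_sSup isNilpotent_staircaseIdeal

/-- Commuting with `E a b` forces column `a` and row `b` of `x` to vanish off the diagonal and gives
`x a a = x b b`. Letting `(a, b)` run over pairs in increasing blocks leaves the corner block plus a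
scalar, and the scalar is zero by the trace condition. -/
theorem mem_staircase_of_commute [CharZero k] (hK : 1 ≤ blockIndex T (Fin.last r)) {x : SL k r}
    (hx : ∀ a b, blockIndex T a < blockIndex T b → ⁅x, rootVec k r a b⁆ = 0) :
    x ∈ staircase k (blockIndex T) (-blockIndex T (Fin.last r)) := by
  have hent : ∀ a b, blockIndex T a < blockIndex T b → ∀ i j,
      (if b = j then x.1 i a else 0) - (if a = i then x.1 b j else 0) = 0 := by
    intro a b h i j
    rw [← lie_rootVec_apply x (by rintro rfl; omega), hx a b h]
    rfl
  have h0 := blockIndex_zero T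
  have hcol : ∀ i a, i ≠ a → blockIndex T a < blockIndex T (Fin.last r) → x.1 i a = 0 := by
    intro i a hia ha
    simpa [hia.symm] using hent a _ ha i (Fin.last r)
  have hrow : ∀ b j, b ≠ j → 0 < blockIndex T b → x.1 b j = 0 := by
    intro b j hbj hb
    simpa [hbj] using hent 0 b (by omega) 0 j
  have hdiag : ∀ a b, blockIndex T a < blockIndex T b → x.1 a a = x.1 b b := by
    intro a b h
    simpa [sub_eq_zero] using hent a b h a b
  -- Indices outside the last block are compared with the last index, and that one with `0`; here `K
  -- ≥ 1` is needed.
  have hconst : ∀ a, x.1 a a = x.1 0 0 := by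
    intro a
    rcases lt_or_ge (blockIndex T a) (blockIndex T (Fin.last r)) with ha | ha
    · rw [hdiag a _ ha, hdiag 0 (Fin.last r) (by omega)]
    · rw [hdiag 0 a (by omega)]
  have htr : Matrix.trace x.1 = 0 := x.2
  have hzero : x.1 0 0 = 0 := by
    simp only [Matrix.trace, Matrix.diag, hconst, Finset.sum_const, Finset.card_univ,
      Fintype.card_fin, nsmul_eq_mul] at htr
    exact (mul_eq_zero.1 htr).resolve_left (Nat.cast_ne_zero.2 (Nat.succ_ne_zero r))
  intro i j hij
  by_cases h : i = j
  · subst h; rw [hconst, hzero]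
  rcases lt_or_ge (blockIndex T j) (blockIndex T (Fin.last r)) with hj | hj
  · exact hcol i j h hj
  · exact hrow i j h (by omega)

theorem rootVec_mem_ideal [CharZero k] {I : LieIdeal k (parabolic k r T)}
    {x : parabolic k r T} (hx : x ∈ I) {a b : Fin (r + 1)} (hab : a ≠ b) (hne : x.1.1 a b ≠ 0) :
    ∃ h : rootVec k r a b ∈ parabolic k r T, (⟨_, h⟩ : parabolic k r T) ∈ I := by
  have : rootVec k r a b ∈ I.toSubmodule.map (parabolic k r T).toSubmodule.subtype := by
    refine rootVec_mem_of_coroot_stable hab ?_ ⟨x, hx, rfl⟩ hne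
    rintro _ ⟨y, hy, rfl⟩
    exact ⟨⁅(⟨_, coroot_mem_parabolic a b⟩ : parabolic k r T), y⁆, I.lie_mem hy, rfl⟩
  obtain ⟨y, hy, hye⟩ := this
  have hye' : y.1 = rootVec k r a b := hye
  have h : rootVec k r a b ∈ parabolic k r T := by rw [← hye']; exact y.2
  refine ⟨h, ?_⟩
  rwa [show (⟨_, h⟩ : parabolic k r T) = y from Subtype.ext hye'.symm]

/-- Nilpotency is contradicted twice: first by an `sl₂` triple in the Levi part, so that `x` has no
off-diagonal Levi entries; then by the corner vector `E a b`, which becomes an eigenvector of `ad x`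
and lies in `I` if its eigenvalue is nonzero. -/
theorem lie_rootVec_eq_zero_of_isNilpotent [CharZero k] {I : LieIdeal k (parabolic k r T)}
    (hI : LieRing.IsNilpotent I) {x : parabolic k r T} (hx : x ∈ I) {a b : Fin (r + 1)}
    (hab : a ≠ b) (ha : blockIndex T a = 0) (hb : blockIndex T b = blockIndex T (Fin.last r)) :
    ⁅x.1, rootVec k r a b⁆ = 0 := by
  -- A nonzero entry puts `E i j` into `I`, hence also the coroot `[E i j, E j i]`, for which `E i
  -- j` has eigenvalue `2`.
  have hlevi : ∀ i j, i ≠ j → blockIndex T i = blockIndex T j → x.1.1 i j = 0 := by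
    intro i j hij hg
    by_contra hne
    obtain ⟨h, hmem⟩ := rootVec_mem_ideal hx hij hne
    have h' : rootVec k r j i ∈ parabolic k r T := rootVec_mem_parabolic j i hij.symm hg.ge
    have hH : ⁅(⟨_, h⟩ : parabolic k r T), (⟨_, h'⟩ : parabolic k r T)⁆ ∈ I := by
      rw [← lie_skew]
      exact I.neg_mem (I.lie_mem hmem)
    have h0 := eq_zero_of_lie_eq_smul hI hH hmem (c := 2) two_ne_zero (Subtype.ext (by
      change ⁅⁅rootVec k r i j, rootVec k r j i⁆, rootVec k r i j⁆ = (2 : k) • rootVec k r i j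
      rw [lie_rootVec_rootVec_self hij, lie_coroot_rootVec hij]))
    exact rootVec_ne_zero hij (congrArg Subtype.val h0)
  have hxs := mem_parabolic_iff.1 x.2
  -- Column `a` (first block) and row `b` (last block) of the block upper triangular `x` have only
  -- Levi entries, so by `hlevi` only diagonal ones.
  have heq : ⁅x.1, rootVec k r a b⁆ = (x.1.1 a a - x.1.1 b b) • rootVec k r a b := by
    ext i j
    change _ = (x.1.1 a a - x.1.1 b b) * (rootVec k r a b).1 i j
    rw [lie_rootVec_apply _ hab, rootVec_apply]
    have hcol : ∀ i, i ≠ a → x.1.1 i a = 0 := by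
      intro i hi
      by_cases h : blockIndex T i = blockIndex T a
      · exact hlevi i a hi h
      · have := blockIndex_nonneg T i
        exact hxs i a (by omega)
    have hrow : ∀ j, b ≠ j → x.1.1 b j = 0 := by
      intro j hj
      by_cases h : blockIndex T b = blockIndex T j
      · exact hlevi b j hj h
      · have := blockIndex_le T j
        exact hxs b j (by omega)
    by_cases hi : a = i <;> by_cases hj : b = j
    · subst hi hj; simp [hab]
    · simp [hi, hj, hrow j hj]
    · simp [hi, hj, hcol i (Ne.symm hi)]
    · simp [hi, hj]
  by_contra hne
  have hc : x.1.1 a a - x.1.1 b b ≠ 0 := by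
    intro hc
    rw [hc, zero_smul] at heq
    exact hne heq
  have hmem : rootVec k r a b ∈ parabolic k r T :=
    rootVec_mem_parabolic a b hab (by rw [ha]; exact blockIndex_nonneg T b)
  have heq' : ⁅x, (⟨_, hmem⟩ : parabolic k r T)⁆ =
      (x.1.1 a a - x.1.1 b b) • (⟨_, hmem⟩ : parabolic k r T) := Subtype.ext heq
  have hI' : (⟨_, hmem⟩ : parabolic k r T) ∈ I := by
    have h1 : ⁅x, (⟨_, hmem⟩ : parabolic k r T)⁆ ∈ I := by
      rw [← lie_skew]
      exact I.neg_mem (I.lie_mem hx)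
    rw [heq'] at h1
    exact (I.toSubmodule.smul_mem_iff hc).1 h1
  exact rootVec_ne_zero hab (congrArg Subtype.val (eq_zero_of_lie_eq_smul hI hx hI' hc heq'))

/-- Annihilating a fixed vector is a linear condition, so it passes from the nilpotent ideals to
their sum; nilpotency of the sum is not needed. -/
theorem lie_rootVec_eq_zero_of_mem_nilradical [CharZero k] {x : parabolic k r T}
    (hx : x ∈ nilradical k (parabolic k r T)) {a b : Fin (r + 1)}
    (hab : a ≠ b) (ha : blockIndex T a = 0) (hb : blockIndex T b = blockIndex T (Fin.last r)) :
    ⁅x.1, rootVec k r a b⁆ = 0 := by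
  let V : Submodule k (parabolic k r T) :=
    { carrier := {y | ⁅y.1, rootVec k r a b⁆ = 0}
      add_mem' := fun {y z} hy hz => by
        change ⁅y.1 + z.1, rootVec k r a b⁆ = 0
        rw [add_lie, hy, hz, add_zero]
      zero_mem' := zero_lie _
      smul_mem' := fun c y hy => by
        change ⁅c • y.1, rootVec k r a b⁆ = 0
        rw [smul_lie, hy, smul_zero] }
  have hle : (nilradical k (parabolic k r T)).toSubmodule ≤ V := by
    rw [nilradical, LieSubmodule.sSup_toSubmodule]
    refine sSup_le ?_
    rintro _ ⟨I, hI, rfl⟩ y hy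
    exact lie_rootVec_eq_zero_of_isNilpotent hI hy hab ha hb
  exact hle hx

/-- It suffices to know that the nilradical contains `F_(-1)` and annihilates the corner root
vectors; it need not be computed. For `K = 0` the corner would be all of `𝔤`. -/
theorem mem_nilCentre_parabolic_iff [CharZero k] (hK : 1 ≤ blockIndex T (Fin.last r))
    {x : parabolic k r T} : x ∈ nilCentre k (parabolic k r T) ↔
      x.1 ∈ staircase k (blockIndex T) (-blockIndex T (Fin.last r)) := by
  constructor
  · intro hx
    refine mem_staircase_of_commute hK fun a b hab => ?_
    have h1 : rootVec k r a b ∈ staircase k (blockIndex T) (-1) :=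
      rootVec_mem_staircase (by omega)
    have h2 := hx.2 ⟨_, staircase_le_parabolic (by omega) h1⟩ (staircaseIdeal_le_nilradical h1)
    exact congrArg Subtype.val h2
  · intro hx
    refine ⟨staircaseIdeal_le_nilradical (staircase_mono (by omega) hx), fun y hy => ?_⟩
    apply Subtype.ext
    change ⁅x.1, y.1⁆ = 0
    rw [← lie_skew, neg_eq_zero]
    let V : Submodule k (SL k r) := LinearMap.ker (LieModule.toEnd k (SL k r) (SL k r) y.1)
    refine mem_of_rootVec_mem (V := V) hx (Or.inr fun i => hx i i (by omega)) fun a b hab h => ?_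
    have h1 := blockIndex_nonneg T a
    have h2 := blockIndex_le T b
    exact lie_rootVec_eq_zero_of_mem_nilradical hy hab (by omega) (by omega)

end ParabolicNilradical

/-! ### Coefficients in the loop algebra and the affine staircase subalgebra. -/

section LoopCoefficients

variable {k : Type*} [Field k] {r : ℕ}

theorem Loop.eq_sum_mono (a : Loop k r) :
    a = ∑ m ∈ (Loop.coeffs k r a).support, Loop.mono k r m (Loop.coeffs k r a m) := by
  apply (Loop.coeffs k r).injective
  rw [map_sum]
  simp only [Loop.coeffs_mono]
  exact (Finsupp.sum_single _).symm

theorem Loop.coeffs_D (a : Loop k r) (m : ℤ) :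
    Loop.coeffs k r (Loop.D k r a) m = (m : k) • Loop.coeffs k r a m := by
  induction a using Loop.induction with
  | h0 => simp
  | hadd a b ha hb => simp only [map_add, Finsupp.add_apply, ha, hb, smul_add]
  | hm n x =>
    rw [Loop.D_mono, map_smul, Loop.coeffs_mono, Finsupp.smul_apply, Finsupp.single_apply]
    split_ifs with h
    · rw [h]
    · simp

/-- The elements of the loop algebra whose coefficient of `tᵐ` is in `staircase k g (m * N)`. -/
def Loop.staircase (k : Type*) [Field k] (g : Fin (r + 1) → ℤ) (N : ℤ) :
    Submodule k (Loop k r) where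
  carrier := {a | ∀ m, Loop.coeffs k r a m ∈ AffineSeaweed.staircase k g (m * N)}
  add_mem' {a b} ha hb m := by
    rw [map_add, Finsupp.add_apply]
    exact Submodule.add_mem _ (ha m) (hb m)
  zero_mem' m := by
    rw [map_zero]
    exact Submodule.zero_mem _
  smul_mem' c a ha m := by
    rw [map_smul, Finsupp.smul_apply]
    exact Submodule.smul_mem _ c (ha m)

variable {g : Fin (r + 1) → ℤ} {N : ℤ}

theorem Loop.mono_mem_staircase {m : ℤ} {x : SL k r}
    (hx : x ∈ AffineSeaweed.staircase k g (m * N)) :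
    Loop.mono k r m x ∈ Loop.staircase k g N := by
  intro n
  rw [Loop.coeffs_mono, Finsupp.single_apply]
  split_ifs with h
  · exact h ▸ hx
  · exact Submodule.zero_mem _

theorem Loop.lie_mem_staircase {a b : Loop k r} (ha : a ∈ Loop.staircase k g N)
    (hb : b ∈ Loop.staircase k g N) : ⁅a, b⁆ ∈ Loop.staircase k g N := by
  rw [Loop.eq_sum_mono a, Loop.eq_sum_mono b, sum_lie]
  refine Submodule.sum_mem _ fun m _ => ?_
  rw [lie_sum]
  refine Submodule.sum_mem _ fun n _ => ?_
  rw [Loop.lie_mono]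
  refine Loop.mono_mem_staircase ?_
  rw [add_mul]
  exact AffineSeaweed.lie_mem_staircase (ha m) (hb n)

theorem Loop.D_mem_staircase {a : Loop k r} (ha : a ∈ Loop.staircase k g N) :
    Loop.D k r a ∈ Loop.staircase k g N := by
  intro m
  rw [Loop.coeffs_D]
  exact Submodule.smul_mem _ _ (ha m)

/-- The elements of the affine algebra whose coefficient of `tᵐ` is in `staircase k g (m * N)`. -/
def affStaircase (k : Type*) [Field k] (g : Fin (r + 1) → ℤ) (N : ℤ) :
    LieSubalgebra k (Aff k r) where
  carrier := {x | x.loop ∈ Loop.staircase k g N}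
  add_mem' hx hy := (Loop.staircase k g N).add_mem hx hy
  zero_mem' := (Loop.staircase k g N).zero_mem
  smul_mem' c _ hx := (Loop.staircase k g N).smul_mem c hx
  lie_mem' hx hy := by
    refine Submodule.sub_mem _ (Submodule.add_mem _ (Loop.lie_mem_staircase hx hy) ?_) ?_
    · exact Submodule.smul_mem _ _ (Loop.D_mem_staircase hy)
    · exact Submodule.smul_mem _ _ (Loop.D_mem_staircase hx)

theorem Aff.t_mem_affStaircase {m : ℤ} {x : SL k r} (hx : x ∈ staircase k g (m * N)) :
    Aff.t k r m x ∈ affStaircase k g N :=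
  Loop.mono_mem_staircase hx

theorem Aff.coeffs_t (m : ℤ) (x : SL k r) :
    Loop.coeffs k r (Aff.t k r m x).loop = Finsupp.single m x :=
  Loop.coeffs_mono k r m x

theorem Aff.t_injective (m : ℤ) : Function.Injective (Aff.t k r m) := by
  intro x y h
  have := congrArg (fun z => Loop.coeffs k r z.loop m) h
  simpa only [Aff.coeffs_t, Finsupp.single_eq_same] using this

theorem Aff.lie_t (m n : ℤ) (x y : SL k r) : ⁅Aff.t k r m x, Aff.t k r n y⁆ =
    Aff.t k r (m + n) ⁅x, y⁆ + (if m + n = 0 then (m : k) * form k r x y else 0) • Aff.C k r := by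
  by_cases h : m + n = 0
  · rw [if_pos h]
    ext1 <;> simp [Aff.t, Aff.C, Loop.lie_mono, Loop.cocycle_mono, h]
  · rw [if_neg h]
    ext1 <;> simp [Aff.t, Aff.C, Loop.lie_mono, Loop.cocycle_mono, h]

theorem Aff.lie_t_of_ne {m n : ℤ} (h : m + n ≠ 0) (x y : SL k r) :
    ⁅Aff.t k r m x, Aff.t k r n y⁆ = Aff.t k r (m + n) ⁅x, y⁆ := by
  rw [Aff.lie_t, if_neg h, zero_smul, add_zero]

theorem Aff.lie_t_zero (x y : SL k r) :
    ⁅Aff.t k r 0 x, Aff.t k r 0 y⁆ = Aff.t k r 0 ⁅x, y⁆ := by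
  simp [Aff.lie_t]

variable (k r) in
/-- The inclusion of `𝔤` in the affine algebra. -/
def Aff.tZero : SL k r →ₗ⁅k⁆ Aff k r where
  __ := Aff.t k r 0
  map_lie' {x y} := (Aff.lie_t_zero x y).symm

theorem Aff.eq_sum_t (x : Aff k r) :
    x = ∑ m ∈ (Loop.coeffs k r x.loop).support, Aff.t k r m (Loop.coeffs k r x.loop m) +
      x.der • Aff.d k r + x.cen • Aff.C k r := by
  have hsum : ∑ m ∈ (Loop.coeffs k r x.loop).support, Aff.t k r m (Loop.coeffs k r x.loop m) =
      ⟨x.loop, 0, 0⟩ := by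
    let ι : Loop k r →ₗ[k] Aff k r :=
      { toFun := fun a => ⟨a, 0, 0⟩
        map_add' := fun a b => by ext1 <;> simp
        map_smul' := fun c a => by ext1 <;> simp }
    change _ = ι x.loop
    conv_rhs => rw [Loop.eq_sum_mono x.loop, map_sum]
    rfl
  rw [hsum]
  ext1 <;> simp [Aff.C, Aff.d]

end LoopCoefficients

/-! ### Lower and upper bounds for affine parabolics. -/

section AffineParabolic

variable {k : Type*} [Field k] {r : ℕ} {S : Set (Fin (r + 1))}

theorem affCartan_le_affBorel : affCartan k r ≤ affBorel k r :=
  le_sup_right.trans le_sup_left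

theorem C_mem_affCartan : Aff.C k r ∈ affCartan k r :=
  Submodule.mem_sup_right (Submodule.subset_span (Or.inl rfl))

theorem d_mem_affCartan : Aff.d k r ∈ affCartan k r :=
  Submodule.mem_sup_right (Submodule.subset_span (Or.inr rfl))

theorem mem_affParabolic_of_mem_affBorel {x : Aff k r} (hx : x ∈ affBorel k r) :
    x ∈ affParabolic k r S :=
  LieSubalgebra.subset_lieSpan (Or.inl hx)

theorem t_mem_affParabolic_of_pos {m : ℤ} (hm : 1 ≤ m) (x : SL k r) :
    Aff.t k r m x ∈ affParabolic k r S :=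
  mem_affParabolic_of_mem_affBorel (Submodule.mem_sup_right
    (Submodule.mem_iSup_of_mem (⟨m, hm⟩ : {m : ℤ // 1 ≤ m}) ⟨x, rfl⟩))

theorem t_zero_mem_affParabolic {x : SL k r} (hx : x ∈ parabolic k r (finitePart S)) :
    Aff.t k r 0 x ∈ affParabolic k r S := by
  suffices parabolic k r (finitePart S) ≤ (affParabolic k r S).comap (Aff.tZero k r) from this hx
  rw [parabolic, LieSubalgebra.lieSpan_le]
  rintro y (hy | ⟨i, hi, rfl⟩)
  · exact mem_affParabolic_of_mem_affBorel
      (Submodule.mem_sup_left (Submodule.mem_sup_left ⟨y, hy, rfl⟩))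
  · exact LieSubalgebra.subset_lieSpan (Or.inr ⟨i.succ, hi, rfl⟩)

theorem t_eHigh_mem_affParabolic (h0 : 0 ∈ S) :
    Aff.t k r (-1) (eHigh k r) ∈ affParabolic k r S :=
  LieSubalgebra.subset_lieSpan (Or.inr ⟨0, h0, rfl⟩)

/-- The corner block is generated from `E 0 (Fin.last r)` under the Levi subalgebra: bracketing with
`E (Fin.last r) b` moves the column inside the last block, and with `E a 0` the row inside the
first. The total degree `-1` produces no central term. -/
theorem t_neg_one_mem_affParabolic (h0 : 0 ∈ S)
    (hK : 1 ≤ blockIndex (finitePart S) (Fin.last r)) {w : SL k r}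
    (hw : w ∈ staircase k (blockIndex (finitePart S))
      (-blockIndex (finitePart S) (Fin.last r))) :
    Aff.t k r (-1) w ∈ affParabolic k r S := by
  have hz := blockIndex_zero (finitePart S)
  refine mem_of_rootVec_mem (V := (affParabolic k r S).toSubmodule.comap (Aff.t k r (-1))) hw
    (Or.inr fun i => hw i i (by omega)) fun a b hab h => ?_
  have ha := blockIndex_nonneg (finitePart S) a
  have hb := blockIndex_le (finitePart S) b
  have h0l : (0 : Fin (r + 1)) ≠ Fin.last r := by
    intro h; rw [← h] at hK; omega
  have h0b : (0 : Fin (r + 1)) ≠ b := by rintro rfl; omega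
  have hfirst : Aff.t k r (-1) (rootVec k r 0 b) ∈ affParabolic k r S := by
    rcases eq_or_ne (Fin.last r) b with rfl | hlb
    · exact t_eHigh_mem_affParabolic h0
    · have := LieSubalgebra.lie_mem _ (t_eHigh_mem_affParabolic (k := k) h0)
        (t_zero_mem_affParabolic (S := S) (rootVec_mem_parabolic _ _ hlb (by omega)))
      rwa [Aff.lie_t_of_ne (by norm_num), eHigh, lie_rootVec_rootVec h0l hlb h0b] at this
  rcases eq_or_ne a 0 with rfl | ha0
  · exact hfirst
  · have := LieSubalgebra.lie_mem _ (t_zero_mem_affParabolic (S := S)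
      (rootVec_mem_parabolic (k := k) _ _ ha0 (by omega))) hfirst
    rwa [Aff.lie_t_of_ne (by norm_num), lie_rootVec_rootVec ha0 h0b hab] at this

/-- Checked on generators: `K ≤ N` makes every positive degree unrestricted, while `e_λ t⁻¹` needs
`N ≤ K`. Without `α₀` the slope `N` may exceed `K`, and then all negative degrees are excluded. -/
theorem affParabolic_le_affStaircase {N : ℤ}
    (hN : blockIndex (finitePart S) (Fin.last r) ≤ N)
    (h0 : 0 ∈ S → N ≤ blockIndex (finitePart S) (Fin.last r)) :
    affParabolic k r S ≤ affStaircase k (blockIndex (finitePart S)) N := by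
  have hpar : ∀ x ∈ parabolic k r (finitePart S),
      Aff.t k r 0 x ∈ affStaircase k (blockIndex (finitePart S)) N := fun x hx =>
    Aff.t_mem_affStaircase (by rw [zero_mul]; exact mem_parabolic_iff.1 hx)
  have hz := blockIndex_zero (finitePart S)
  have hnn := blockIndex_nonneg (finitePart S) (Fin.last r)
  rw [affParabolic, LieSubalgebra.lieSpan_le]
  rintro x (hx | ⟨i, hi, rfl⟩)
  · suffices affBorel k r ≤ (affStaircase k (blockIndex (finitePart S)) N).toSubmodule from this hx
    refine sup_le (sup_le ?_ (sup_le ?_ ?_)) (iSup_le ?_)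
    · rintro _ ⟨y, hy, rfl⟩
      exact hpar y (borel_le_parabolic _ hy)
    · rintro _ ⟨y, hy, rfl⟩
      exact hpar y (borel_le_parabolic _ (cartan_le_borel hy))
    · rw [Submodule.span_le]
      rintro _ (rfl | rfl) <;> exact (Loop.staircase k _ N).zero_mem
    · rintro ⟨m, hm⟩ _ ⟨y, rfl⟩
      refine Aff.t_mem_affStaircase ?_
      rw [staircase_eq_top]
      · trivial
      · intro i j
        have h1 := blockIndex_le (finitePart S) i
        have h2 := blockIndex_nonneg (finitePart S) j
        nlinarith
  · induction i using Fin.cases with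
    | zero =>
      refine Aff.t_mem_affStaircase (rootVec_mem_staircase ?_)
      have := h0 hi
      omega
    | succ i => exact hpar _ (eNeg_mem_parabolic hi)

end AffineParabolic

/-! ### The action of an opposition on degrees, root vectors and parabolics. -/

section Opposition

variable {k : Type*} [Field k] {r : ℕ}

/-- The component `𝔤 tᵐ → 𝔤 t⁻ᵐ` of an automorphism of the affine algebra, as a map of `𝔤`. -/
def degreeComponent (ω : Aff k r ≃ₗ⁅k⁆ Aff k r) (m : ℤ) : SL k r →ₗ[k] SL k r where
  toFun x := Loop.coeffs k r (ω (Aff.t k r m x)).loop (-m)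
  map_add' x y := by
    rw [map_add, map_add, Aff.add_loop, map_add, Finsupp.add_apply]
  map_smul' c x := by
    rw [map_smul, map_smul, Aff.smul_loop, map_smul, Finsupp.smul_apply, RingHom.id_apply]

variable {ω : Aff k r ≃ₗ⁅k⁆ Aff k r}

namespace IsOpposition

theorem apply_t (hω : IsOpposition ω) (m : ℤ) (x : SL k r) :
    ω (Aff.t k r m x) = Aff.t k r (-m) (degreeComponent ω m x) := by
  have h : ω (Aff.t k r m x) ∈ LinearMap.range (Aff.t k r (-m)) := by
    rw [← hω.degree m]
    exact ⟨_, ⟨x, rfl⟩, rfl⟩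
  obtain ⟨y, hy⟩ := h
  have : degreeComponent ω m x = y := by
    change Loop.coeffs k r (ω (Aff.t k r m x)).loop (-m) = y
    rw [← hy, Aff.coeffs_t, Finsupp.single_eq_same]
  rw [this, hy]

theorem apply_t_zero (hω : IsOpposition ω) (x : SL k r) :
    ω (Aff.t k r 0 x) = Aff.t k r 0 (degreeComponent ω 0 x) := by
  rw [hω.apply_t, neg_zero]

theorem degreeComponent_injective (hω : IsOpposition ω) (m : ℤ) :
    Function.Injective (degreeComponent ω m) := by
  intro x y h
  apply Aff.t_injective m
  apply ω.injective
  change ω _ = ω _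
  rw [hω.apply_t, hω.apply_t, h]

theorem degreeComponent_neg (hω : IsOpposition ω) (m : ℤ) (x : SL k r) :
    degreeComponent ω (-m) (degreeComponent ω m x) = x := by
  apply Aff.t_injective m
  have h := hω.apply_t (-m) (degreeComponent ω m x)
  rw [neg_neg, ← hω.apply_t, hω.involutive] at h
  exact h.symm

theorem degreeComponent_zero (hω : IsOpposition ω) (x : SL k r) :
    degreeComponent ω 0 (degreeComponent ω 0 x) = x := by
  simpa using hω.degreeComponent_neg 0 x

/-- The involution of `𝔤` induced by an opposition. -/
def degreeZero (hω : IsOpposition ω) : SL k r ≃ₗ⁅k⁆ SL k r where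
  __ := degreeComponent ω 0
  invFun := degreeComponent ω 0
  left_inv := hω.degreeComponent_zero
  right_inv := hω.degreeComponent_zero
  map_lie' {x y} := by
    apply Aff.t_injective 0
    change Aff.t k r 0 (degreeComponent ω 0 ⁅x, y⁆) =
      Aff.t k r 0 ⁅degreeComponent ω 0 x, degreeComponent ω 0 y⁆
    rw [← hω.apply_t_zero, ← Aff.lie_t_zero, LieEquiv.map_lie, hω.apply_t_zero,
      hω.apply_t_zero, Aff.lie_t_zero]

theorem apply_t_zero' (hω : IsOpposition ω) (x : SL k r) :
    ω (Aff.t k r 0 x) = Aff.t k r 0 (hω.degreeZero x) :=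
  hω.apply_t_zero x

theorem degreeZero_degreeZero (hω : IsOpposition ω) (x : SL k r) :
    hω.degreeZero (hω.degreeZero x) = x :=
  hω.degreeComponent_zero x

theorem degreeZero_cartan (hω : IsOpposition ω) {x : SL k r} (hx : x ∈ AffineSeaweed.cartan k r) :
    hω.degreeZero x = -x := by
  apply Aff.t_injective 0
  rw [← hω.apply_t_zero', hω.cartan _ (Submodule.mem_sup_left ⟨x, hx, rfl⟩), map_neg]

/-- Since `ω` negates the coroot, the image has eigenvalue `-2` under it, and that eigenspace is
spanned by `E j i`. -/
theorem degreeZero_rootVec [CharZero k] (hω : IsOpposition ω) {i j : Fin (r + 1)} (hij : i ≠ j) :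
    ∃ c : k, c ≠ 0 ∧ hω.degreeZero (rootVec k r i j) = c • rootVec k r j i := by
  set y := hω.degreeZero (rootVec k r i j) with hy
  have hlie : ⁅coroot k r i j, y⁆ = (-2 : k) • y := by
    have h := congrArg hω.degreeZero (lie_coroot_rootVec (k := k) hij)
    rw [LieEquiv.map_lie, hω.degreeZero_cartan (coroot_mem_cartan i j), map_smul, ← hy,
      neg_lie] at h
    rw [neg_smul, ← h, neg_neg]
  have heq : y = y.1 j i • rootVec k r j i := by
    ext a b
    change y.1 a b = y.1 j i * (rootVec k r j i).1 a b
    have h : (⁅coroot k r i j, y⁆ : SL k r).1 a b = -2 * y.1 a b := by rw [hlie]; rfl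
    rw [lie_coroot_apply] at h
    rw [rootVec_apply]
    rcases coroot_eigenvalue_cases (k := k) hij a b with ⟨rfl, rfl, hd⟩ | ⟨rfl, rfl, hd⟩ |
      ⟨-, hn, hd⟩
    · rw [hd] at h
      rw [if_neg (fun h' => hij h'.2.1.symm), mul_zero]
      -- Here and below, the coefficient is the eigenvalue at the entry minus `-2`, nonzero in
      -- characteristic zero.
      have h4 : (4 : k) * y.1 a b = 0 := by linear_combination h
      exact (mul_eq_zero.1 h4).resolve_left (by norm_num)
    · rw [if_pos ⟨hij.symm, rfl, rfl⟩, mul_one]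
    · rw [if_neg (fun h' => hn ⟨h'.2.1.symm, h'.2.2.symm⟩), mul_zero]
      rcases hd with hd | hd | hd <;> rw [hd] at h
      · have h4 : (2 : k) * y.1 a b = 0 := by linear_combination h
        exact (mul_eq_zero.1 h4).resolve_left (by norm_num)
      · have h4 : (3 : k) * y.1 a b = 0 := by linear_combination h
        exact (mul_eq_zero.1 h4).resolve_left (by norm_num)
      · linear_combination h
  refine ⟨y.1 j i, fun h0 => ?_, heq⟩
  rw [h0, zero_smul] at heq
  refine rootVec_ne_zero (k := k) hij (hω.degreeZero.injective ?_)
  exact heq.trans (map_zero hω.degreeZero.toLieHom).symm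

theorem rootVec_mem_map_degreeZero [CharZero k] (hω : IsOpposition ω) {i j : Fin (r + 1)}
    (hij : i ≠ j) {V : LieSubalgebra k (SL k r)} (h : rootVec k r i j ∈ V) :
    rootVec k r j i ∈ V.map hω.degreeZero.toLieHom := by
  obtain ⟨c, hc, he⟩ := hω.degreeZero_rootVec hij
  have : c • rootVec k r j i ∈ (V.map hω.degreeZero.toLieHom).toSubmodule := ⟨_, h, he⟩
  exact (Submodule.smul_mem_iff _ hc).1 this

/-- The generators `e_α` and `ω(e_{-α})` differ only by nonzero scalars. -/
theorem parabolicOpp_eq_map [CharZero k] (hω : IsOpposition ω) (T : Set (Fin r)) :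
    parabolicOpp ω T = (parabolic k r T).map hω.degreeZero.toLieHom := by
  apply le_antisymm
  · rw [parabolicOpp, LieSubalgebra.lieSpan_le]
    rintro x (⟨y, hy, hyx⟩ | ⟨i, hi, rfl⟩)
    · rw [hω.apply_t_zero'] at hyx
      exact ⟨y, borel_le_parabolic T hy, Aff.t_injective 0 hyx⟩
    · exact hω.rootVec_mem_map_degreeZero (ne_of_gt (Fin.castSucc_lt_succ (i := i)))
        (eNeg_mem_parabolic hi)
  · rw [LieSubalgebra.map_le_iff_le_comap, parabolic, LieSubalgebra.lieSpan_le]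
    rintro x (hx | ⟨i, hi, rfl⟩)
    · exact LieSubalgebra.subset_lieSpan (Or.inl ⟨x, hx, hω.apply_t_zero' x⟩)
    · obtain ⟨c, -, he⟩ := hω.degreeZero_rootVec (k := k)
        (ne_of_gt (Fin.castSucc_lt_succ (i := i)))
      change hω.degreeZero (eNeg k r i) ∈ parabolicOpp ω T
      rw [eNeg, he]
      exact (parabolicOpp ω T).smul_mem c (LieSubalgebra.subset_lieSpan (Or.inr ⟨i, hi, rfl⟩))

theorem mem_parabolicOpp_iff [CharZero k] (hω : IsOpposition ω) {T : Set (Fin r)} {x : SL k r} :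
    x ∈ parabolicOpp ω T ↔ degreeComponent ω 0 x ∈ parabolic k r T := by
  rw [hω.parabolicOpp_eq_map]
  constructor
  · rintro ⟨y, hy, rfl⟩
    change hω.degreeZero (hω.degreeZero y) ∈ parabolic k r T
    rwa [hω.degreeZero_degreeZero]
  · exact fun hx => ⟨_, hx, hω.degreeZero_degreeZero x⟩

theorem isSeaweed [CharZero k] (hω : IsOpposition ω) (T T' : Set (Fin r)) :
    IsSeaweed (parabolic k r T ⊓ parabolicOpp ω T') := by
  refine ⟨_, _, ⟨borel k r, ⟨LieEquiv.refl, ?_⟩, borel_le_parabolic T⟩,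
    ⟨(borel k r).map hω.degreeZero.toLieHom, ⟨hω.degreeZero, rfl⟩, ?_⟩, ?_, rfl⟩
  · ext x
    exact ⟨fun hx => ⟨x, hx, rfl⟩, by rintro ⟨y, hy, rfl⟩; exact hy⟩
  · rw [hω.parabolicOpp_eq_map]
    rintro _ ⟨y, hy, rfl⟩
    exact ⟨y, borel_le_parabolic T' hy, rfl⟩
  · rw [eq_top_iff]
    intro x _
    -- A constant `g` imposes no condition. The sum is `𝔤` because `𝔟` supplies the diagonal and
    -- upper root vectors, and `ω(𝔟)` the lower ones.
    have hx : x ∈ staircase k (fun _ : Fin (r + 1) => (0 : ℤ)) 0 := fun _ _ h => absurd h (by simp)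
    refine mem_of_rootVec_mem hx (Or.inl ?_) fun i j hij _ => ?_
    · exact (cartan_le_borel.trans (borel_le_parabolic T)).trans le_sup_left
    · rcases lt_or_gt_of_ne hij with h | h
      · exact Submodule.mem_sup_left (borel_le_parabolic T (rootVec_mem_borel h))
      · refine Submodule.mem_sup_right ?_
        rw [hω.parabolicOpp_eq_map]
        exact hω.rootVec_mem_map_degreeZero hij.symm
          (borel_le_parabolic T' (rootVec_mem_borel h))

/-- Extends the degree reversal to arbitrary elements: `C` and `d` are only negated, so they
contribute nothing to any loop coefficient. -/
theorem coeffs_apply (hω : IsOpposition ω) (x : Aff k r) (m : ℤ) :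
    Loop.coeffs k r (ω x).loop (-m) = degreeComponent ω m (Loop.coeffs k r x.loop m) := by
  let F : Aff k r →ₗ[k] SL k r :=
    { toFun := fun x => Loop.coeffs k r x.loop m
      map_add' := fun x y => by rw [Aff.add_loop, map_add, Finsupp.add_apply]
      map_smul' := fun c x => by
        rw [Aff.smul_loop, map_smul, Finsupp.smul_apply, RingHom.id_apply] }
  let G : Aff k r →ₗ[k] SL k r :=
    { toFun := fun x => Loop.coeffs k r (ω x).loop (-m)
      map_add' := fun x y => by rw [map_add, Aff.add_loop, map_add, Finsupp.add_apply]
      map_smul' := fun c x => by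
        rw [map_smul, Aff.smul_loop, map_smul, Finsupp.smul_apply, RingHom.id_apply] }
  change G x = degreeComponent ω m (F x)
  have hc : ∀ y ∈ affCartan k r, y.loop = 0 → G y = degreeComponent ω m (F y) := by
    intro y hy h0
    change Loop.coeffs k r (ω y).loop (-m) = degreeComponent ω m (Loop.coeffs k r y.loop m)
    rw [hω.cartan y hy, Aff.neg_loop, h0]
    simp
  have ht : ∀ n y, G (Aff.t k r n y) = degreeComponent ω m (F (Aff.t k r n y)) := by
    intro n y
    change Loop.coeffs k r (ω (Aff.t k r n y)).loop (-m) =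
      degreeComponent ω m (Loop.coeffs k r (Aff.t k r n y).loop m)
    rw [hω.apply_t, Aff.coeffs_t, Aff.coeffs_t, Finsupp.single_apply, Finsupp.single_apply]
    by_cases h : n = m
    · rw [if_pos (by rw [h]), if_pos h, h]
    · rw [if_neg (fun h' => h (neg_injective h')), if_neg h, map_zero]
  rw [Aff.eq_sum_t x]
  simp only [map_add, map_smul, map_sum, ht, hc _ d_mem_affCartan rfl, hc _ C_mem_affCartan rfl]

end IsOpposition

end Opposition

/-! ### The graded pieces of the affine seaweed and the role of finite dimension. -/

section AffineSeaweeds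

variable {k : Type*} [Field k] {r : ℕ} {ω : Aff k r ≃ₗ⁅k⁆ Aff k r} {S S' : Set (Fin (r + 1))}

namespace IsOpposition

theorem mem_affSeaweed_iff (hω : IsOpposition ω) {x : Aff k r} :
    x ∈ affSeaweed ω S S' ↔ x ∈ affParabolic k r S ∧ ω x ∈ affParabolic k r S' := by
  refine and_congr_right fun _ => ⟨?_, fun h => ⟨ω x, h, hω.involutive x⟩⟩
  rintro ⟨y, hy, rfl⟩
  change ω (ω y) ∈ affParabolic k r S'
  rwa [hω.involutive]

theorem mem_affSeaweed_of_mem_affCartan (hω : IsOpposition ω) {x : Aff k r}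
    (hx : x ∈ affCartan k r) : x ∈ affSeaweed ω S S' := by
  rw [hω.mem_affSeaweed_iff, hω.cartan x hx]
  exact ⟨mem_affParabolic_of_mem_affBorel (affCartan_le_affBorel hx),
    neg_mem (mem_affParabolic_of_mem_affBorel (affCartan_le_affBorel hx))⟩

theorem t_mem_affSeaweed_of_neg (hω : IsOpposition ω) {m : ℤ} (hm : m < 0) {x : SL k r}
    (hx : Aff.t k r m x ∈ affParabolic k r S) : Aff.t k r m x ∈ affSeaweed ω S S' := by
  rw [hω.mem_affSeaweed_iff, hω.apply_t]
  exact ⟨hx, t_mem_affParabolic_of_pos (by omega) _⟩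

theorem t_zero_mem_affSeaweed [CharZero k] (hω : IsOpposition ω) {x : SL k r}
    (hx : x ∈ parabolic k r (finitePart S) ⊓ parabolicOpp ω (finitePart S')) :
    Aff.t k r 0 x ∈ affSeaweed ω S S' := by
  rw [hω.mem_affSeaweed_iff, hω.apply_t_zero]
  exact ⟨t_zero_mem_affParabolic hx.1,
    t_zero_mem_affParabolic (hω.mem_parabolicOpp_iff.1 hx.2)⟩

/-- Membership in `𝔭(S)` bounds the degree below by `-1`, and membership of `ω x` in `𝔭(S')` bounds
it above by `0`. The parameter `N` covers both cases: `K` if `α₀ ∈ S`, and `K + 1` otherwise. -/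
theorem coeffs_of_mem_affSeaweed [CharZero k] (hω : IsOpposition ω) (hS' : 0 ∉ S') {N : ℤ}
    (hN1 : 1 ≤ N) (hN : blockIndex (finitePart S) (Fin.last r) ≤ N)
    (h0 : 0 ∈ S → N ≤ blockIndex (finitePart S) (Fin.last r)) {x : Aff k r}
    (hx : x ∈ affSeaweed ω S S') :
    Loop.coeffs k r x.loop 0 ∈ parabolic k r (finitePart S) ⊓ parabolicOpp ω (finitePart S') ∧
      Loop.coeffs k r x.loop (-1) ∈ staircase k (blockIndex (finitePart S)) (-N) ∧
      x = Aff.t k r (-1) (Loop.coeffs k r x.loop (-1)) + Aff.t k r 0 (Loop.coeffs k r x.loop 0) +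
        x.der • Aff.d k r + x.cen • Aff.C k r := by
  rw [hω.mem_affSeaweed_iff] at hx
  have h1 : ∀ m, Loop.coeffs k r x.loop m ∈ staircase k (blockIndex (finitePart S)) (m * N) :=
    affParabolic_le_affStaircase hN h0 hx.1
  have h2 : ∀ m, degreeComponent ω m (Loop.coeffs k r x.loop m) ∈
      staircase k (blockIndex (finitePart S'))
        (-m * (blockIndex (finitePart S') (Fin.last r) + 1)) := by
    intro m
    rw [← hω.coeffs_apply]
    -- The slope is one more than the last block number of `S'`, which is allowed because `α₀ ∉ S'`;
    -- it kills every negative degree of `ω x`.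
    exact affParabolic_le_affStaircase (by omega) (fun h => absurd h hS') hx.2 (-m)
  have hpos : ∀ m, 0 < m → Loop.coeffs k r x.loop m = 0 := by
    intro m hm
    have h := h2 m
    rw [staircase_eq_bot, Submodule.mem_bot] at h
    · exact hω.degreeComponent_injective m (h.trans (map_zero _).symm)
    · intro i j
      have h3 := blockIndex_nonneg (finitePart S') i
      have h4 := blockIndex_le (finitePart S') j
      have h5 := blockIndex_nonneg (finitePart S') (Fin.last r)
      nlinarith
  have hneg : ∀ m, m < -1 → Loop.coeffs k r x.loop m = 0 := by
    intro m hm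
    have h := h1 m
    rw [staircase_eq_bot, Submodule.mem_bot] at h
    · exact h
    · intro i j
      have h3 := blockIndex_nonneg (finitePart S) i
      have h4 := blockIndex_le (finitePart S) j
      nlinarith
  refine ⟨⟨?_, ?_⟩, ?_, ?_⟩
  · have h := h1 0
    rw [zero_mul] at h
    exact mem_parabolic_iff.2 h
  · have h := h2 0
    rw [neg_zero, zero_mul] at h
    exact hω.mem_parabolicOpp_iff.2 (mem_parabolic_iff.2 h)
  · have h := h1 (-1)
    rwa [neg_one_mul] at h
  · conv_lhs => rw [Aff.eq_sum_t x]
    congr 2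
    rw [Finset.sum_subset (s₂ := {-1, 0})]
    · rw [Finset.sum_pair (by norm_num)]
    · intro m hm
      rw [Finsupp.mem_support_iff] at hm
      rw [Finset.mem_insert, Finset.mem_singleton]
      by_contra hcon
      rcases lt_trichotomy m 0 with h | h | h
      · exact hm (hneg m (by omega))
      · omega
      · exact hm (hpos m h)
    · intro m _ hm
      rw [Finsupp.notMem_support_iff.1 hm, map_zero]

end IsOpposition

/-- If `K = 0` then `e_{-λ}` is available, so `h t⁻¹ = [e_λ t⁻¹, e_{-λ}]` with `h` the coroot of
`λ`, and `ad (h t⁻¹)` lowers the degree of `e_λ t⁻ᵐ` by one up to the factor `2`. -/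
theorem t_neg_eHigh_mem_affParabolic [CharZero k] (hr : 1 ≤ r) (h0 : 0 ∈ S)
    (hK : blockIndex (finitePart S) (Fin.last r) = 0) (m : ℕ) :
    Aff.t k r (-(m + 1 : ℤ)) (eHigh k r) ∈ affParabolic k r S := by
  have h0l : (0 : Fin (r + 1)) ≠ Fin.last r := by
    intro h
    have := congrArg Fin.val h
    simp at this
    omega
  have hf : rootVec k r (Fin.last r) 0 ∈ parabolic k r (finitePart S) :=
    rootVec_mem_parabolic _ _ h0l.symm (by rw [hK, blockIndex_zero])
  have hh : Aff.t k r (-1) (coroot k r 0 (Fin.last r)) ∈ affParabolic k r S := by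
    have := LieSubalgebra.lie_mem _ (t_eHigh_mem_affParabolic (k := k) h0)
      (t_zero_mem_affParabolic hf)
    rwa [Aff.lie_t_of_ne (by norm_num), eHigh, lie_rootVec_rootVec_self h0l] at this
  induction m with
  | zero => simpa using t_eHigh_mem_affParabolic h0
  | succ m ih =>
    have := LieSubalgebra.lie_mem _ hh ih
    rw [Aff.lie_t_of_ne (by omega), eHigh, lie_coroot_rootVec h0l, map_smul] at this
    rw [show -(((m + 1 : ℕ) : ℤ) + 1) = -1 + -((m : ℤ) + 1) by push_cast; ring]
    exact ((affParabolic k r S).toSubmodule.smul_mem_iff two_ne_zero).1 this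

theorem IsOpposition.one_le_blockIndex_of_finiteDimensional [CharZero k] (hr : 1 ≤ r)
    (hω : IsOpposition ω) (h0 : 0 ∈ S) (hfin : FiniteDimensional k (affSeaweed ω S S')) :
    1 ≤ blockIndex (finitePart S) (Fin.last r) := by
  by_contra hlt
  have hK : blockIndex (finitePart S) (Fin.last r) = 0 := by
    have := blockIndex_nonneg (finitePart S) (Fin.last r)
    omega
  have h0l : (0 : Fin (r + 1)) ≠ Fin.last r := by
    intro h
    have := congrArg Fin.val h
    simp at this
    omega
  let v : ℕ → affSeaweed ω S S' := fun m => ⟨_, hω.t_mem_affSeaweed_of_neg (by omega)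
    (t_neg_eHigh_mem_affParabolic hr h0 hK m)⟩
  let F : affSeaweed ω S S' →ₗ[k] (ℤ →₀ SL k r) :=
    { toFun := fun x => Loop.coeffs k r x.1.loop
      map_add' := fun x y => (Loop.coeffs k r).map_add x.1.loop y.1.loop
      map_smul' := fun c x => (Loop.coeffs k r).map_smul c x.1.loop }
  -- The vectors lie in pairwise distinct degrees, so each coefficient can be isolated.
  have hli : LinearIndependent k v := by
    apply LinearIndependent.of_comp F
    rw [linearIndependent_iff']
    intro s c hc m hm
    have h := DFunLike.congr_fun hc (-(m + 1 : ℤ))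
    rw [Finsupp.finsetSum_apply, Finset.sum_eq_single m] at h
    · have hv : F (v m) = Finsupp.single (-(m + 1 : ℤ)) (eHigh k r) := Aff.coeffs_t _ _
      rw [Function.comp_apply, hv, Finsupp.smul_apply, Finsupp.single_eq_same] at h
      exact (smul_eq_zero.1 h).resolve_right (rootVec_ne_zero h0l)
    · intro n _ hn
      have hv : F (v n) = Finsupp.single (-(n + 1 : ℤ)) (eHigh k r) := Aff.coeffs_t _ _
      rw [Function.comp_apply, hv, Finsupp.smul_apply, Finsupp.single_eq_of_ne (by omega),
        smul_zero]
    · exact fun h => absurd hm h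
  exact not_finite_iff_infinite.2 (inferInstanceAs (Infinite ℕ)) hli.finite

/-! ### The natural homomorphisms and their images. -/

theorem exists_lieEquiv_of_injective {L M : Type*} [LieRing L] [LieAlgebra k L] [LieRing M]
    [LieAlgebra k M] (f : L →ₗ⁅k⁆ M) (hf : Function.Injective f) (K : LieSubalgebra k M)
    (h : ∀ y, y ∈ K ↔ ∃ x, f x = y) : ∃ φ : L ≃ₗ⁅k⁆ K, ∀ x, (φ x : M) = f x := by
  obtain rfl : K = f.range := by
    ext y
    rw [h, LieHom.mem_range]
  exact ⟨LieEquiv.ofInjective f hf, fun _ => rfl⟩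

/-- The natural map from `q ⊕ k d ⊕ k C` to the affine algebra. -/
def trivialExtensionHom (q : LieSubalgebra k (SL k r)) : (q × k × k) →ₗ⁅k⁆ Aff k r where
  toFun x := Aff.t k r 0 x.1 + x.2.1 • Aff.d k r + x.2.2 • Aff.C k r
  map_add' x y := by
    change Aff.t k r 0 ((x.1 : SL k r) + y.1) + (x.2.1 + y.2.1) • Aff.d k r +
      (x.2.2 + y.2.2) • Aff.C k r = _
    simp only [map_add, add_smul]
    abel
  map_smul' c x := by
    change Aff.t k r 0 (c • (x.1 : SL k r)) + (c * x.2.1) • Aff.d k r +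
      (c * x.2.2) • Aff.C k r = _
    simp only [map_smul, smul_add, smul_smul, RingHom.id_apply]
  map_lie' {x y} := by
    obtain ⟨a, δ, c⟩ := x
    obtain ⟨a', δ', c'⟩ := y
    change Aff.t k r 0 ⁅(a : SL k r), (a' : SL k r)⁆ + (δ * δ' - δ' * δ) • Aff.d k r +
      (c * c' - c' * c) • Aff.C k r =
      ⁅Aff.t k r 0 (a : SL k r) + δ • Aff.d k r + c • Aff.C k r,
        Aff.t k r 0 (a' : SL k r) + δ' • Aff.d k r + c' • Aff.C k r⁆
    -- The factors `k` carry the commutator bracket, which vanishes by commutativity.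
    rw [mul_comm δ' δ, mul_comm c' c]
    ext1
    · simp [Aff.t, Aff.C, Aff.d, Loop.lie_mono, Loop.D_mono]
    · simp [Aff.t, Aff.C, Aff.d, Loop.cocycle_mono]
    · simp [Aff.t, Aff.C, Aff.d]

/-- The natural map from `(q ⊕ k d ⊕ k C) ⋉ 𝔷 t⁻¹` to the affine algebra, where `𝔷` is the centre of
the nilradical of a subalgebra `p` that contains `q`. -/
def semidirectHom {p q : LieSubalgebra k (SL k r)} (h : q ≤ p) :
    LieAlgebra.SemiDirectSum (nilCentre k p) (q × k × k)
      (semidirectAction (LieSubalgebra.inclusion h)) →ₗ⁅k⁆ Aff k r where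
  toFun x := Aff.t k r (-1) x.left.1 + Aff.t k r 0 x.right.1 +
    x.right.2.1 • Aff.d k r + x.right.2.2 • Aff.C k r
  map_add' x y := by
    change Aff.t k r (-1) ((x.left.1 : SL k r) + y.left.1) +
      Aff.t k r 0 ((x.right.1 : SL k r) + y.right.1) +
      (x.right.2.1 + y.right.2.1) • Aff.d k r + (x.right.2.2 + y.right.2.2) • Aff.C k r = _
    simp only [map_add, add_smul]
    abel
  map_smul' c x := by
    change Aff.t k r (-1) (c • (x.left.1 : SL k r)) + Aff.t k r 0 (c • (x.right.1 : SL k r)) +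
      (c * x.right.2.1) • Aff.d k r + (c * x.right.2.2) • Aff.C k r = _
    simp only [map_smul, smul_add, smul_smul, RingHom.id_apply]
  map_lie' {x y} := by
    obtain ⟨w, a, δ, c⟩ := x
    obtain ⟨w', a', δ', c'⟩ := y
    -- This removes the degree `-2` term of the bracket.
    have hz : ⁅(w.1 : SL k r), (w'.1 : SL k r)⁆ = 0 :=
      congrArg (fun z : nilCentre k p => (z.1 : SL k r)) (nilCentre_lie w w')
    change Aff.t k r (-1) (⁅(w.1 : SL k r), (w'.1 : SL k r)⁆ +
        (⁅(a : SL k r), (w'.1 : SL k r)⁆ - δ • (w'.1 : SL k r)) -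
        (⁅(a' : SL k r), (w.1 : SL k r)⁆ - δ' • (w.1 : SL k r))) +
      Aff.t k r 0 ⁅(a : SL k r), (a' : SL k r)⁆ +
      (δ * δ' - δ' * δ) • Aff.d k r + (c * c' - c' * c) • Aff.C k r =
      ⁅Aff.t k r (-1) (w.1 : SL k r) + Aff.t k r 0 (a : SL k r) + δ • Aff.d k r + c • Aff.C k r,
        Aff.t k r (-1) (w'.1 : SL k r) + Aff.t k r 0 (a' : SL k r) + δ' • Aff.d k r +
          c' • Aff.C k r⁆
    rw [mul_comm δ' δ, mul_comm c' c]
    have hs := lie_skew (w.1 : SL k r) (a' : SL k r)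
    ext1
    · simp [Aff.t, Aff.C, Aff.d, Loop.lie_mono, Loop.D_mono, hz]
      rw [← hs, map_neg]
      abel
    · simp [Aff.t, Aff.C, Aff.d, Loop.cocycle_mono]
    · simp [Aff.t, Aff.C, Aff.d]

theorem coeffs_t_neg_one_add (w a : SL k r) (δ c : k) (m : ℤ) :
    Loop.coeffs k r (Aff.t k r (-1) w + Aff.t k r 0 a + δ • Aff.d k r + c • Aff.C k r).loop m =
      Finsupp.single (-1) w m + Finsupp.single 0 a m := by
  simp only [Aff.add_loop, Aff.smul_loop, map_add, map_smul, Finsupp.add_apply, Aff.coeffs_t]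
  simp [Aff.C, Aff.d]

theorem t_neg_one_add_injective {w a w' a' : SL k r} {δ c δ' c' : k}
    (h : Aff.t k r (-1) w + Aff.t k r 0 a + δ • Aff.d k r + c • Aff.C k r =
      Aff.t k r (-1) w' + Aff.t k r 0 a' + δ' • Aff.d k r + c' • Aff.C k r) :
    w = w' ∧ a = a' ∧ δ = δ' ∧ c = c' := by
  have hm := fun m => congrArg (fun x => Loop.coeffs k r x.loop m) h
  simp only [coeffs_t_neg_one_add] at hm
  refine ⟨by simpa using hm (-1), by simpa using hm 0, ?_, ?_⟩
  · simpa [Aff.t, Aff.C, Aff.d] using congrArg Aff.der h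
  · simpa [Aff.t, Aff.C, Aff.d] using congrArg Aff.cen h

theorem IsOpposition.exists_lieEquiv_trivialExtension [CharZero k] (hω : IsOpposition ω)
    (hS' : 0 ∉ S') (h0 : 0 ∉ S) {q : LieSubalgebra k (SL k r)}
    (hq : q = parabolic k r (finitePart S) ⊓ parabolicOpp ω (finitePart S')) :
    ∃ φ : (q × k × k) ≃ₗ⁅k⁆ affSeaweed ω S S', ∀ (a : q) (δ c : k),
      (φ (a, δ, c) : Aff k r) = Aff.t k r 0 a + δ • Aff.d k r + c • Aff.C k r := by
  suffices ∃ φ : (q × k × k) ≃ₗ⁅k⁆ affSeaweed ω S S', ∀ x, (φ x : Aff k r) =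
      trivialExtensionHom q x by
    obtain ⟨φ, hφ⟩ := this
    exact ⟨φ, fun a δ c => hφ _⟩
  apply exists_lieEquiv_of_injective
  · rintro ⟨a, δ, c⟩ ⟨a', δ', c'⟩ h
    change Aff.t k r 0 a.1 + δ • Aff.d k r + c • Aff.C k r =
      Aff.t k r 0 a'.1 + δ' • Aff.d k r + c' • Aff.C k r at h
    -- The case without `𝔷 t⁻¹` is the general injectivity statement with zero component in degree
    -- `-1`.
    obtain ⟨-, ha, hδ, hc⟩ := t_neg_one_add_injective (w := 0) (a := (a : SL k r)) (δ := δ)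
      (c := c) (w' := 0) (a' := (a' : SL k r)) (δ' := δ') (c' := c')
      (by rw [map_zero, zero_add, zero_add]; exact h)
    rw [Subtype.ext ha, hδ, hc]
  · intro y
    constructor
    · intro hy
      have hnn := blockIndex_nonneg (finitePart S) (Fin.last r)
      obtain ⟨h1, h2, h3⟩ := hω.coeffs_of_mem_affSeaweed hS'
        -- With slope `K + 1` the coefficient of `t⁻¹` lies in `F_(-K-1) = 0`.
        (N := blockIndex (finitePart S) (Fin.last r) + 1) (by omega) (by omega)
        (fun h => absurd h h0) hy
      rw [staircase_eq_bot, Submodule.mem_bot] at h2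
      · rw [h2, map_zero, zero_add] at h3
        exact ⟨(⟨_, hq ▸ h1⟩, y.der, y.cen), h3.symm⟩
      · intro i j
        have h4 := blockIndex_nonneg (finitePart S) i
        have h5 := blockIndex_le (finitePart S) j
        omega
    · rintro ⟨⟨⟨a, ha⟩, δ, c⟩, rfl⟩
      rw [hq] at ha
      exact add_mem (add_mem (hω.t_zero_mem_affSeaweed ha)
        ((affSeaweed ω S S').smul_mem δ (hω.mem_affSeaweed_of_mem_affCartan d_mem_affCartan)))
        ((affSeaweed ω S S').smul_mem c (hω.mem_affSeaweed_of_mem_affCartan C_mem_affCartan))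

theorem IsOpposition.exists_lieEquiv_semidirect [CharZero k] (hω : IsOpposition ω)
    (hS' : 0 ∉ S') (h0 : 0 ∈ S) (hK : 1 ≤ blockIndex (finitePart S) (Fin.last r))
    {q : LieSubalgebra k (SL k r)}
    (hq : q = parabolic k r (finitePart S) ⊓ parabolicOpp ω (finitePart S'))
    (hle : q ≤ parabolic k r (finitePart S)) :
    ∃ φ : LieAlgebra.SemiDirectSum (nilCentre k (parabolic k r (finitePart S))) (q × k × k)
        (semidirectAction (LieSubalgebra.inclusion hle)) ≃ₗ⁅k⁆ affSeaweed ω S S',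
      ∀ (w : nilCentre k (parabolic k r (finitePart S))) (a : q) (δ c : k),
        (φ ⟨w, (a, δ, c)⟩ : Aff k r) = Aff.t k r (-1) w.1 + Aff.t k r 0 a + δ • Aff.d k r +
          c • Aff.C k r := by
  suffices ∃ φ : LieAlgebra.SemiDirectSum (nilCentre k (parabolic k r (finitePart S))) (q × k × k)
      (semidirectAction (LieSubalgebra.inclusion hle)) ≃ₗ⁅k⁆ affSeaweed ω S S',
      ∀ x, (φ x : Aff k r) = semidirectHom hle x by
    obtain ⟨φ, hφ⟩ := this
    exact ⟨φ, fun w a δ c => hφ _⟩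
  apply exists_lieEquiv_of_injective
  · rintro ⟨w, a, δ, c⟩ ⟨w', a', δ', c'⟩ h
    obtain ⟨hw, ha, hδ, hc⟩ := t_neg_one_add_injective h
    dsimp only at hw ha hδ hc
    rw [Subtype.ext (Subtype.ext hw), Subtype.ext ha, hδ, hc]
  · intro y
    constructor
    · intro hy
      -- With slope exactly `K` the coefficient of `t⁻¹` lies in the corner block, which is `𝔷`.
      obtain ⟨h1, h2, h3⟩ := hω.coeffs_of_mem_affSeaweed hS' hK le_rfl (fun _ => le_rfl) hy
      have hp := staircase_le_parabolic (by omega) h2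
      exact ⟨⟨⟨⟨_, hp⟩, (mem_nilCentre_parabolic_iff hK).2 h2⟩, (⟨_, hq ▸ h1⟩, y.der, y.cen)⟩,
        h3.symm⟩
    · rintro ⟨⟨⟨w, hw⟩, ⟨a, ha⟩, δ, c⟩, rfl⟩
      rw [hq] at ha
      have hw' := t_neg_one_mem_affParabolic h0 hK ((mem_nilCentre_parabolic_iff hK).1 hw)
      exact add_mem (add_mem (add_mem (hω.t_mem_affSeaweed_of_neg (by norm_num) hw')
        (hω.t_zero_mem_affSeaweed ha))
        ((affSeaweed ω S S').smul_mem δ (hω.mem_affSeaweed_of_mem_affCartan d_mem_affCartan)))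
        ((affSeaweed ω S S').smul_mem c (hω.mem_affSeaweed_of_mem_affCartan C_mem_affCartan))

end AffineSeaweeds

end AffineSeaweed

end

theorem mainTheorem4 {k : Type*} [Field k] [CharZero k] (r : ℕ) (hr : 1 ≤ r)
    (ω : AffineSeaweed.Aff k r ≃ₗ⁅k⁆ AffineSeaweed.Aff k r) (hω : AffineSeaweed.IsOpposition ω)
    (S S' : Set (Fin (r + 1))) (hS' : 0 ∉ S')
    (hfin : FiniteDimensional k (AffineSeaweed.affSeaweed ω S S')) :
    let p : LieSubalgebra k (AffineSeaweed.SL k r) :=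
      AffineSeaweed.parabolic k r (AffineSeaweed.finitePart S)
    let q : LieSubalgebra k (AffineSeaweed.SL k r) :=
      p ⊓ AffineSeaweed.parabolicOpp ω (AffineSeaweed.finitePart S')
    let ψ : (q × k × k) →ₗ⁅k⁆
        LieDerivation k (AffineSeaweed.nilCentre k p) (AffineSeaweed.nilCentre k p) :=
      AffineSeaweed.semidirectAction (LieSubalgebra.inclusion (inf_le_left : q ≤ p))
    AffineSeaweed.IsSeaweed q ∧
    (0 ∉ S →
      ∃ φ : (q × k × k) ≃ₗ⁅k⁆ AffineSeaweed.affSeaweed ω S S',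
        ∀ (a : q) (δ c : k), (φ (a, δ, c) : AffineSeaweed.Aff k r) =
          AffineSeaweed.Aff.t k r 0 a + δ • AffineSeaweed.Aff.d k r +
            c • AffineSeaweed.Aff.C k r) ∧
    (0 ∈ S →
      ∃ φ : LieAlgebra.SemiDirectSum (AffineSeaweed.nilCentre k p) (q × k × k) ψ ≃ₗ⁅k⁆
          AffineSeaweed.affSeaweed ω S S',
        ∀ (w : AffineSeaweed.nilCentre k p) (a : q) (δ c : k),
          (φ ⟨w, (a, δ, c)⟩ : AffineSeaweed.Aff k r) =
            AffineSeaweed.Aff.t k r (-1) w.1 + AffineSeaweed.Aff.t k r 0 a +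
              δ • AffineSeaweed.Aff.d k r + c • AffineSeaweed.Aff.C k r) := by
  intro p q ψ
  exact ⟨hω.isSeaweed _ _, fun h0 => hω.exists_lieEquiv_trivialExtension hS' h0 rfl,
    fun h0 => hω.exists_lieEquiv_semidirect hS' h0
      (hω.one_le_blockIndex_of_finiteDimensional hr h0 hfin) rfl inf_le_left⟩
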